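/- Let $g$ be a probability density on $\mathbb{R}$ with Fourier coefficients $\gamma_k=\int_{\mathbb{R}} e^{-2i\pi kx}g(x)\,dx$, and assume that for some $\beta\ge 0$ and $C_{\max}\ge C_{\min}>0$, $$C_{\min}|k|^{-\beta}\le|\gamma_k|\le C_{\max}|k|^{-\beta}\qquad\text{for all } k\in\mathbb{Z}\setminus\{0\}.$$ For a $1$-periodic $f:\mathbb{R}\to\mathbb{R}$ that is square integrable on $[0,1]$, put $\theta_k=\int_0^1 e^{-2i\pi kx}f(x)\,dx$, $\theta=(\theta_k)_{k\in\mathbb{Z}}$, $\|\theta\|^2=\sum_{k\in\mathbb{Z}}|\theta_k|^2$. For $n\ge 2$ curves and a noise level $\epsilon>0$ one observes $$c_{j,k}=\theta_k e^{-2i\pi k\tau_j}+\epsilon z_{k,j},\qquad j=1,\dots,n,\ k\in\mathbb{Z},$$ where the shifts $\tau_1,\dots,\tau_n$ are i.i.d. with density $g$, the $z_{k,j}$ are i.i.d. centred complex Gaussian variables whose real and imaginary parts are independent with variance $1/2$, and the shifts are independent of the $z_{k,j}$. Let $\tilde c_k=\frac1n\sum_{j=1}^n c_{j,k}$, let $m_0=\inf\{k\in\mathbb{N}:|\gamma_k|^2\le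 \log^2(n)/n\}-1$, and $$\tilde U(Y,N)=-\sum_{|k|\le N}|\gamma_k|^{-2}\Big\{|\tilde c_k|^2-\frac{\epsilon^2}{n}\Big\}+\frac{\epsilon^2}{n}\sum_{|k|\le N}|\gamma_k|^{-2}.$$ Let $\tilde N$ be a (measurable) minimizer of $N\mapsto\tilde U(Y,N)$ over $0\le N\le m_0$, and let $\tilde\theta_k=\frac{\tilde c_k}{\gamma_k}\mathbf 1_{\{|k|\le\tilde N\}}$. For deterministic $N$ let $R(\theta,N)=\mathbb{E}\sum_{k\in\mathbb{Z}}\big|\frac{\tilde c_k}{\gamma_k}\mathbf 1_{\{|k|\le N\}}-\theta_k\big|^2$ be the quadratic risk of the projection estimator with cut-off $N$. Then there are $0<\gamma_2<1$ and a function $h_2$ with $h_2(\gamma)\to0$ as $\gamma\to0^+$, both depending only on $g$ (and on $\beta, C_{\min},C_{\max}$), and for every $A$ there is a constant $C_2>0$, depending only on $g$, $\beta$, $C_{\min}$, $C_{\max}$ and $A$ (in particular not on $\epsilon$, $n$ or $\gamma$), such that for all $f$ as above with $\|\theta\|^2\le A$, all $n\ge2$, all $\epsilon>0$ and all $0<\gamma<\gamma_2$,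 $$\mathbb{E}\|\tilde\theta-\theta\|^2\le(1+h_2(\gamma))\inf_{0\le N\le m_0}R(\theta,N)+\frac{C_2\epsilon^2}{n}\left(\frac{\|\theta\|^2\log^2(n)}{\gamma^2}\right)^{2\beta}+\frac{C_2\epsilon^2}{n}\frac{1}{\gamma^{4\beta+1}}+\frac{C_2}{n}.$$ -/

import Mathlib

open MeasureTheory ProbabilityTheory
open scoped Topology ENNReal

noncomputable section

namespace RandomShift

/-- `g` is a probability density on the real line. -/
structure IsDensity (g : ℝ → ℝ) : Prop where
  measurable : Measurable g
  nonneg : ∀ x, 0 ≤ g x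
  lintegral_eq_one : ∫⁻ x, ENNReal.ofReal (g x) = 1

/-- The character `x ↦ exp (-2 i π k x)`. -/
def character (k : ℤ) (x : ℝ) : ℂ :=
  Complex.exp (-2 * Complex.I * Real.pi * k * x)

/-- The Fourier coefficients `γ_k` of the density `g` of the shifts. -/
def shiftCoeff (g : ℝ → ℝ) (k : ℤ) : ℂ :=
  ∫ x : ℝ, character k x * (g x : ℂ)

/-- The Fourier coefficients `θ_k` of the template `f` on one period. -/
def templateCoeff (f : ℝ → ℝ) (k : ℤ) : ℂ :=
  ∫ x in (0 : ℝ)..1, character k x * (f x : ℂ)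

/-- Polynomial decay of the Fourier coefficients of `g`
(at `k = 0` the coefficient is `1` and the condition is void). -/
def PolynomialDecay (g : ℝ → ℝ) (β Cmin Cmax : ℝ) : Prop :=
  ∀ k : ℤ, k ≠ 0 →
    Cmin * |(k : ℝ)| ^ (-β) ≤ ‖shiftCoeff g k‖ ∧
      ‖shiftCoeff g k‖ ≤ Cmax * |(k : ℝ)| ^ (-β)

/-- The squared `ℓ²(ℤ)` norm of a sequence. -/
def normSq (θ : ℤ → ℂ) : ℝ := ∑' k : ℤ, ‖θ k‖ ^ 2

/-- The centred complex Gaussian law `x + i y`, with `x` and `y` independent of variance `1/2`. -/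
def stdComplexGaussian : Measure ℂ :=
  ((gaussianReal 0 (1 / 2)).prod (gaussianReal 0 (1 / 2))).map
    (fun p : ℝ × ℝ => (p.1 : ℂ) + (p.2 : ℂ) * Complex.I)

/-- The random objects of the model: `n` i.i.d. shifts `τ j` with density `g`, an i.i.d. family of
standard complex Gaussian variables `z k j`, and independence of the shifts from the noise. -/
structure IsShiftModel {Ω : Type*} [MeasurableSpace Ω] (μ : Measure Ω) (g : ℝ → ℝ) {n : ℕ}
    (τ : Fin n → Ω → ℝ) (z : ℤ → Fin n → Ω → ℂ) : Prop where
  measurable_shift : ∀ j, Measurable (τ j)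
  law_shift : ∀ j, μ.map (τ j) = volume.withDensity (fun x => ENNReal.ofReal (g x))
  indep_shift : iIndepFun τ μ
  measurable_noise : ∀ k j, Measurable (z k j)
  law_noise : ∀ k j, μ.map (z k j) = stdComplexGaussian
  indep_noise : iIndepFun (fun p : ℤ × Fin n => z p.1 p.2) μ
  indep_shift_noise :
    IndepFun (fun ω (j : Fin n) => τ j ω) (fun ω (p : ℤ × Fin n) => z p.1 p.2 ω) μ

/-- The observed Fourier coefficient `c_{j,k} = θ_k exp (-2 i π k τ_j) + ε z_{k,j}` of the curve
number `j`. -/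
def observedCoeff {Ω : Type*} {n : ℕ} (f : ℝ → ℝ) (ε : ℝ) (τ : Fin n → Ω → ℝ)
    (z : ℤ → Fin n → Ω → ℂ) (j : Fin n) (k : ℤ) (ω : Ω) : ℂ :=
  templateCoeff f k * character k (τ j ω) + (ε : ℂ) * z k j ω

/-- The empirical mean of the observed `k`-th Fourier coefficients over the `n` curves. -/
def meanCoeff {Ω : Type*} {n : ℕ} (f : ℝ → ℝ) (ε : ℝ) (τ : Fin n → Ω → ℝ)
    (z : ℤ → Fin n → Ω → ℂ) (k : ℤ) (ω : Ω) : ℂ :=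
  (1 / (n : ℂ)) * ∑ j : Fin n, observedCoeff f ε τ z j k ω

/-- The projection filter with cut-off `N`. -/
def cutoffFilter (N : ℕ) (k : ℤ) : ℝ := if |k| ≤ (N : ℤ) then 1 else 0

/-- The filtered deconvolution estimator `lam_k c_k / γ_k` computed from the coefficients `c`. -/
def filterEstimator (g : ℝ → ℝ) (lam : ℤ → ℝ) (c : ℤ → ℂ) (k : ℤ) : ℂ :=
  (lam k : ℂ) * (c k / shiftCoeff g k)

/-- The squared `ℓ²(ℤ)` distance of two sequences. -/
def sqLoss (a b : ℤ → ℂ) : ℝ≥0∞ := ∑' k : ℤ, ‖a k - b k‖ₑ ^ 2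

/-- The quadratic risk of the projection estimator whose cut-off `N` may be random. -/
def cutoffRisk {Ω : Type*} [MeasurableSpace Ω] (μ : Measure Ω) {n : ℕ} (g f : ℝ → ℝ) (ε : ℝ)
    (τ : Fin n → Ω → ℝ) (z : ℤ → Fin n → Ω → ℂ) (N : Ω → ℕ) : ℝ≥0∞ :=
  ∫⁻ ω, sqLoss
    (filterEstimator g (cutoffFilter (N ω)) (fun k => meanCoeff f ε τ z k ω))
    (templateCoeff f) ∂μ

/-- The maximal cut-off `m₀ = inf {k : |γ_k|² ≤ log² n / n} - 1`. -/
def maxCutoff (g : ℝ → ℝ) (n : ℕ) : ℕ :=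
  sInf {k : ℕ | ‖shiftCoeff g k‖ ^ 2 ≤ Real.log n ^ 2 / n} - 1

/-- The unpenalized unbiased risk criterion, evaluated at mean coefficients `c`. -/
def criterion (g : ℝ → ℝ) (ε : ℝ) (n : ℕ) (c : ℤ → ℂ) (N : ℕ) : ℝ :=
  -(∑ k ∈ Finset.Icc (-(N : ℤ)) N, (‖shiftCoeff g k‖ ^ 2)⁻¹ * (‖c k‖ ^ 2 - ε ^ 2 / n))
    + ε ^ 2 / n * ∑ k ∈ Finset.Icc (-(N : ℤ)) N, (‖shiftCoeff g k‖ ^ 2)⁻¹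

/-- `M` minimizes the criterion over the cut-offs `N ≤ m₀`. -/
def IsCriterionMin (g : ℝ → ℝ) (ε : ℝ) (n : ℕ) (c : ℤ → ℂ) (M : ℕ) : Prop :=
  M ≤ maxCutoff g n ∧ ∀ N ≤ maxCutoff g n, criterion g ε n c M ≤ criterion g ε n c N

end RandomShift

end

/-! After division by `γ_k`, the mean coefficient is `u_k + e_k`: the signal `u_k` is `θ_k` times
the ratio of the empirical to the true Fourier coefficient of the shifts, and the noise `e_k` is
independent Gaussian, independent of the shifts, with variance `s_k = (ε²/n)|γ_k|⁻²`. The criterion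
becomes `∑ (2 s_k - |u_k + e_k|²)` over `|k| ≤ N`, an unbiased risk estimate up to the error `u - θ`
and the fluctuations of `e`.

The deterministic core is `loss_le_of_criterion_le`. Suppose `|u_k - θ_k| ≤ t|θ_k|` for `|k| ≤ m₀`,
and the linear and quadratic fluctuations of `e` stay below `κ` times their natural size plus `E`.
Then a minimizer loses to a fixed cut-off `M` at most a multiple of `(t + κ)(bias + variance at M) +
E`, and also at most a multiple of `total variance up to m₀ + E`.

The probabilistic inputs are as follows. Since `m₀` keeps `n|γ_k|²` above `log² n`, Hoeffding's
inequality gives the closeness of `u` to `θ` with `t` of order `(log n)^(-1/2)`, outside an event of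
polynomially small probability (`measureReal_not_goodShifts_le`); there a crude bound of the loss
suffices. Since `|γ_k|⁻²` grows polynomially, Chernoff bounds at each cut-off are summable, and the
mean of `E` is at most a constant times `(ε²/n) κ^(-(2r+5))` (`lintegral_noiseOvershoot_le`).

Choosing `κ = γ^(1/(2r+5))` turns the last bound into `ε²/(nγ)`. If a suitable power of `n` is at
most `1/γ`, the total variance is itself of order `ε²/(nγ)`; otherwise `log n` dominates `-log γ`,
so `t` is bounded by a function of `γ` that tends to `0` and joins `h₂`. Small `n` is covered by the
crude bound. -/

noncomputable section

namespace RandomShift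

/-! ### Deterministic comparison of the losses at two cut-offs. -/

/-- Comparison of the losses when the selected cut-off lies above the reference cut-off. -/
lemma excess_le_of_above {κ t b r₁ r₂ X X' W₁ W₂ S I T E : ℝ} (hκ : 0 ≤ κ) (hκ' : κ ≤ 1 / 16)
    (ht : 0 ≤ t) (ht' : t ≤ 1 / 4) (hb : 0 ≤ b) (hr₁ : r₁ ≤ t * b) (hr₁' : 0 ≤ r₁)
    (hr₂' : 0 ≤ r₂) (hr₂ : r₂ ≤ b + 3 * (t * b)) (hS : 0 ≤ S) (hI : 0 ≤ I) (hT : S + I ≤ T)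
    (hcrit : I ≤ r₂ + 2 * X + (W₂ - W₁))
    (hX : |X| ≤ κ * r₂ + κ * (S + I) + E) (hX' : |X'| ≤ κ * r₁ + κ * (S + I) + E)
    (hW₁ : |W₁| ≤ κ * S + E) (hW₂ : |W₂| ≤ κ * (S + I) + E) (hE : 0 ≤ E) :
    -b + r₁ + 2 * X' + (W₂ - W₁) + I ≤ 100 * ((t + κ) * (b + S) + E) ∧
      -b + r₁ + 2 * X' + (W₂ - W₁) + I ≤ 100 * (T + E) := by
  have htb : t * b ≤ 1 / 4 * b := mul_le_mul_of_nonneg_right ht' hb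
  have htb0 : 0 ≤ t * b := mul_nonneg ht hb
  have h1 : κ * r₂ ≤ 1 / 16 * r₂ := mul_le_mul_of_nonneg_right hκ' hr₂'
  have h2 : κ * r₂ ≤ κ * (2 * b) := mul_le_mul_of_nonneg_left (by linarith) hκ
  have h3 : κ * r₁ ≤ κ * b := mul_le_mul_of_nonneg_left (by linarith) hκ
  have h3' : κ * b ≤ 1 / 16 * b := mul_le_mul_of_nonneg_right hκ' hb
  have h4 : κ * S ≤ 1 / 16 * S := mul_le_mul_of_nonneg_right hκ' hS
  have h5 : κ * I ≤ 1 / 16 * I := mul_le_mul_of_nonneg_right hκ' hI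
  have h6 : 0 ≤ κ * S := mul_nonneg hκ hS
  have h8 : κ * E ≤ 1 / 16 * E := mul_le_mul_of_nonneg_right hκ' hE
  have h9 : 0 ≤ t * S := mul_nonneg ht hS
  have h10 : 0 ≤ κ * b := mul_nonneg hκ hb
  rw [abs_le] at hX hX' hW₁ hW₂
  -- The criterion bounds the added variance `I` by the bias removed; the `κ * I` terms on the right
  -- are absorbed because `κ ≤ 1 / 16`.
  have hI2 : I ≤ 4 * b + S + 8 * E := by linarith [hX.2, hW₂.2, hW₁.1]
  have h7 : κ * I ≤ κ * (4 * b + S + 8 * E) := mul_le_mul_of_nonneg_left hI2 hκ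
  -- First bound: inserting `hcrit` for `I` cancels `-b` against `r₂ ≤ b + 3tb`, leaving only terms
  -- carrying `t`, `κ` or `E`. Second bound: `b` has a negative total coefficient and drops out,
  -- leaving `S + I ≤ T`.
  constructor
  · linarith [hX.2, hW₂.2, hW₁.1, hX'.2]
  · linarith [hX.2, hW₂.2, hW₁.1, hX'.2]

/-- Comparison of the losses when the selected cut-off lies below the reference cut-off. -/
lemma excess_le_of_below {κ t b r₁ r₂ X X' W₁ W₂ S I T E B : ℝ} (hκ : 0 ≤ κ) (hκ' : κ ≤ 1 / 16)
    (ht : 0 ≤ t) (ht' : t ≤ 1 / 4) (hb : 0 ≤ b) (hr₁ : r₁ ≤ t * b) (hr₁' : 0 ≤ r₁)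
    (hr₂' : 0 ≤ r₂) (hr₂ : b - 2 * (t * b) ≤ r₂) (hS : 0 ≤ S) (hI : 0 ≤ I)
    (hT : S + I ≤ T) (hB : 0 ≤ B)
    (hcrit : r₂ + 2 * X + (W₂ - W₁) ≤ I)
    (hX : |X| ≤ κ * r₂ + κ * (S + I) + E) (hX' : |X'| ≤ κ * r₁ + κ * (S + I) + E)
    (hW₁ : |W₁| ≤ κ * S + E) (hW₂ : |W₂| ≤ κ * (S + I) + E) (hE : 0 ≤ E) :
    b - r₁ - 2 * X' - (W₂ - W₁) - I ≤ 100 * ((t + κ) * (B + (S + I)) + E) ∧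
      b - r₁ - 2 * X' - (W₂ - W₁) - I ≤ 100 * (T + E) := by
  have htb : t * b ≤ 1 / 4 * b := mul_le_mul_of_nonneg_right ht' hb
  have htb0 : 0 ≤ t * b := mul_nonneg ht hb
  have h1 : κ * r₂ ≤ 1 / 16 * r₂ := mul_le_mul_of_nonneg_right hκ' hr₂'
  have h3 : κ * r₁ ≤ κ * b := mul_le_mul_of_nonneg_left (by linarith) hκ
  have h4 : κ * S ≤ 1 / 16 * S := mul_le_mul_of_nonneg_right hκ' hS
  have h5 : κ * I ≤ 1 / 16 * I := mul_le_mul_of_nonneg_right hκ' hI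
  have h6 : 0 ≤ κ * S := mul_nonneg hκ hS
  have h6' : 0 ≤ κ * I := mul_nonneg hκ hI
  have h8 : κ * E ≤ 1 / 16 * E := mul_le_mul_of_nonneg_right hκ' hE
  have h9 : 0 ≤ t * B := mul_nonneg ht hB
  have h10 : 0 ≤ κ * B := mul_nonneg hκ hB
  rw [abs_le] at hX hX' hW₁ hW₂
  -- The criterion prefers the smaller cut-off only if the discarded signal is of the order of the
  -- noise variance; hence `b` is controlled by `S + I`, and every `t * b` and `κ * b` is a small
  -- multiple of the variance.
  have hr : r₂ ≤ 2 * (S + I) + 6 * E := by linarith [hX.1, hW₂.1, hW₁.2]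
  have hb2 : b ≤ 4 * (S + I) + 12 * E := by linarith
  have h11 : κ * r₂ ≤ κ * (2 * (S + I) + 6 * E) := mul_le_mul_of_nonneg_left hr hκ
  have h12 : κ * b ≤ κ * (4 * (S + I) + 12 * E) := mul_le_mul_of_nonneg_left hb2 hκ
  have h13 : t * b ≤ t * (4 * (S + I) + 12 * E) := mul_le_mul_of_nonneg_left hb2 ht
  have h14 : t * E ≤ 1 / 4 * E := mul_le_mul_of_nonneg_right ht' hE
  have h15 : t * S ≤ 1 / 4 * S := mul_le_mul_of_nonneg_right ht' hS
  have h16 : t * I ≤ 1 / 4 * I := mul_le_mul_of_nonneg_right ht' hI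
  have h17 : 0 ≤ t * S := mul_nonneg ht hS
  have h18 : 0 ≤ t * I := mul_nonneg ht hI
  constructor
  · linarith [hX.1, hW₂.1, hW₁.2, hX'.1]
  · linarith [hX.1, hW₂.1, hW₁.2, hX'.1]

/-- The frequencies `|k| ≤ N`. -/
def window (N : ℕ) : Finset ℤ := Finset.Icc (-(N : ℤ)) N

lemma mem_window {N : ℕ} {k : ℤ} : k ∈ window N ↔ |k| ≤ (N : ℤ) := by
  simp [window, abs_le]

lemma window_mono {M N : ℕ} (h : M ≤ N) : window M ⊆ window N := fun k hk => by
  rw [mem_window] at *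
  exact hk.trans (by exact_mod_cast h)

/-- The frequencies that separate two cut-offs. -/
def gap (M N : ℕ) : Finset ℤ := window (max M N) \ window (min M N)

lemma gap_of_le {M N : ℕ} (h : M ≤ N) : gap M N = window N \ window M := by
  simp [gap, h]

lemma gap_comm (M N : ℕ) : gap M N = gap N M := by
  simp [gap, max_comm, min_comm]

lemma gap_subset (M N : ℕ) : gap M N ⊆ window (max M N) := Finset.sdiff_subset

lemma sum_window_add_gap {M N : ℕ} (h : M ≤ N) (f : ℤ → ℝ) :
    ∑ k ∈ window N, f k = ∑ k ∈ window M, f k + ∑ k ∈ gap M N, f k := by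
  rw [gap_of_le h, add_comm, Finset.sum_sdiff (window_mono h)]

/-- The deterministic comparison of the loss at a minimizer of the unpenalized criterion with the
loss at a fixed cut-off, for observations `u + e` of `θ`, under control of the deviations of the
noise `e`. -/
theorem loss_le_of_criterion_le {θ u e : ℤ → ℂ} {s : ℤ → ℝ} {m M N : ℕ} {κ t E : ℝ}
    (hκ : 0 ≤ κ) (hκ' : κ ≤ 1 / 16) (ht : 0 ≤ t) (ht' : t ≤ 1 / 4) (hE : 0 ≤ E)
    (hs : ∀ k, 0 ≤ s k) (hM : M ≤ m) (hN : N ≤ m)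
    (hcrit : ∑ k ∈ window N, (2 * s k - ‖u k + e k‖ ^ 2) ≤
      ∑ k ∈ window M, (2 * s k - ‖u k + e k‖ ^ 2))
    (hu : ∀ k ∈ window m, ‖u k - θ k‖ ≤ t * ‖θ k‖)
    (hX : |∑ k ∈ gap M N, inner ℝ (u k) (e k)| ≤
      κ * ∑ k ∈ gap M N, ‖u k‖ ^ 2 + κ * ∑ k ∈ window (max M N), s k + E)
    (hX' : |∑ k ∈ gap M N, inner ℝ (u k - θ k) (e k)| ≤
      κ * ∑ k ∈ gap M N, ‖u k - θ k‖ ^ 2 + κ * ∑ k ∈ window (max M N), s k + E)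
    (hW : ∀ L ≤ m, |∑ k ∈ window L, (‖e k‖ ^ 2 - s k)| ≤ κ * ∑ k ∈ window L, s k + E) :
    (∑ k ∈ window N, (‖u k + e k - θ k‖ ^ 2 - ‖θ k‖ ^ 2) ≤
      ∑ k ∈ window M, (‖u k + e k - θ k‖ ^ 2 - ‖θ k‖ ^ 2) +
        100 * ((t + κ) * (∑ k ∈ gap M m, ‖θ k‖ ^ 2 + ∑ k ∈ window M, s k) + E)) ∧
    (∑ k ∈ window N, (‖u k + e k - θ k‖ ^ 2 - ‖θ k‖ ^ 2) ≤
      ∑ k ∈ window M, (‖u k + e k - θ k‖ ^ 2 - ‖θ k‖ ^ 2) +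
        100 * (∑ k ∈ window m, s k + E)) := by
  set G := gap M N with hG
  have hGm : ∀ k ∈ G, k ∈ window m := fun k hk =>
    window_mono (max_le hM hN) (gap_subset M N hk)
  have exp1 : ∑ k ∈ G, (2 * s k - ‖u k + e k‖ ^ 2) = ∑ k ∈ G, s k - ∑ k ∈ G, ‖u k‖ ^ 2 -
      2 * ∑ k ∈ G, inner ℝ (u k) (e k) - ∑ k ∈ G, (‖e k‖ ^ 2 - s k) := by
    rw [Finset.mul_sum, ← Finset.sum_sub_distrib, ← Finset.sum_sub_distrib,
      ← Finset.sum_sub_distrib]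
    refine Finset.sum_congr rfl fun k _ => ?_
    rw [norm_add_sq_real]; ring
  have exp2 : ∑ k ∈ G, (‖u k + e k - θ k‖ ^ 2 - ‖θ k‖ ^ 2) = -∑ k ∈ G, ‖θ k‖ ^ 2 +
      ∑ k ∈ G, ‖u k - θ k‖ ^ 2 + 2 * ∑ k ∈ G, inner ℝ (u k - θ k) (e k) +
      ∑ k ∈ G, (‖e k‖ ^ 2 - s k) + ∑ k ∈ G, s k := by
    rw [Finset.mul_sum, ← Finset.sum_neg_distrib, ← Finset.sum_add_distrib,
      ← Finset.sum_add_distrib, ← Finset.sum_add_distrib, ← Finset.sum_add_distrib]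
    refine Finset.sum_congr rfl fun k _ => ?_
    rw [add_sub_right_comm, norm_add_sq_real]; ring
  have hb : 0 ≤ ∑ k ∈ G, ‖θ k‖ ^ 2 := Finset.sum_nonneg fun _ _ => by positivity
  have hr1' : 0 ≤ ∑ k ∈ G, ‖u k - θ k‖ ^ 2 := Finset.sum_nonneg fun _ _ => by positivity
  have hr2' : 0 ≤ ∑ k ∈ G, ‖u k‖ ^ 2 := Finset.sum_nonneg fun _ _ => by positivity
  have hsI : 0 ≤ ∑ k ∈ G, s k := Finset.sum_nonneg fun _ _ => hs _
  have hsw : ∀ L, 0 ≤ ∑ k ∈ window L, s k := fun L => Finset.sum_nonneg fun _ _ => hs _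
  have hr1 : ∑ k ∈ G, ‖u k - θ k‖ ^ 2 ≤ t * ∑ k ∈ G, ‖θ k‖ ^ 2 := by
    rw [Finset.mul_sum]
    refine Finset.sum_le_sum fun k hk => ?_
    have h1 := hu k (hGm k hk)
    have h2 : ‖u k - θ k‖ ^ 2 ≤ (t * ‖θ k‖) ^ 2 := pow_le_pow_left₀ (norm_nonneg _) h1 2
    have h3 : t * t ≤ t * 1 := mul_le_mul_of_nonneg_left (by linarith) ht
    nlinarith [sq_nonneg ‖θ k‖]
  have hr2 : ∑ k ∈ G, ‖u k‖ ^ 2 ≤ ∑ k ∈ G, ‖θ k‖ ^ 2 + 3 * (t * ∑ k ∈ G, ‖θ k‖ ^ 2) := by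
    rw [← mul_assoc, Finset.mul_sum, ← Finset.sum_add_distrib]
    refine Finset.sum_le_sum fun k hk => ?_
    have h1 := hu k (hGm k hk)
    have h0 : ‖u k‖ ≤ (1 + t) * ‖θ k‖ := by
      have := norm_add_le (u k - θ k) (θ k)
      rw [sub_add_cancel] at this; linarith
    have h2 : ‖u k‖ ^ 2 ≤ ((1 + t) * ‖θ k‖) ^ 2 := pow_le_pow_left₀ (norm_nonneg _) h0 2
    have h3 : t * t ≤ t * 1 := mul_le_mul_of_nonneg_left (by linarith) ht
    nlinarith [sq_nonneg ‖θ k‖]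
  have hr3 : ∑ k ∈ G, ‖θ k‖ ^ 2 - 2 * (t * ∑ k ∈ G, ‖θ k‖ ^ 2) ≤ ∑ k ∈ G, ‖u k‖ ^ 2 := by
    rw [← mul_assoc, Finset.mul_sum, ← Finset.sum_sub_distrib]
    refine Finset.sum_le_sum fun k hk => ?_
    have h1 := hu k (hGm k hk)
    have h0 : (1 - t) * ‖θ k‖ ≤ ‖u k‖ := by
      have := norm_sub_norm_le (θ k) (u k)
      rw [norm_sub_rev] at this; linarith
    have h2 : ((1 - t) * ‖θ k‖) ^ 2 ≤ ‖u k‖ ^ 2 :=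
      pow_le_pow_left₀ (mul_nonneg (by linarith) (norm_nonneg _)) h0 2
    nlinarith [sq_nonneg ‖θ k‖, mul_nonneg (sq_nonneg t) (sq_nonneg ‖θ k‖)]
  have hgm : ∀ {L}, M ≤ L → ∑ k ∈ gap M L, ‖θ k‖ ^ 2 =
      ∑ k ∈ window L, ‖θ k‖ ^ 2 - ∑ k ∈ window M, ‖θ k‖ ^ 2 := fun h => by
    rw [sum_window_add_gap h]; ring
  have hmm : ∀ {L L'} (f : ℤ → ℝ), (∀ k, 0 ≤ f k) → L ≤ L' →
      ∑ k ∈ window L, f k ≤ ∑ k ∈ window L', f k := fun f hf h =>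
    Finset.sum_le_sum_of_subset_of_nonneg (window_mono h) fun _ _ _ => hf _
  rcases le_total M N with h | h
  · rw [max_eq_right h, sum_window_add_gap h s] at hX hX'
    have hW1 := hW M hM
    have hW2 := hW N hN
    rw [sum_window_add_gap h s] at hW2
    have hww := sum_window_add_gap h fun k => ‖e k‖ ^ 2 - s k
    rw [sum_window_add_gap h, ← hG, exp1] at hcrit
    have hT : ∑ k ∈ window M, s k + ∑ k ∈ gap M N, s k ≤ ∑ k ∈ window m, s k := by
      rw [← sum_window_add_gap h]; exact hmm s hs hN
    have key := excess_le_of_above (W₁ := ∑ k ∈ window M, (‖e k‖ ^ 2 - s k))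
      (W₂ := ∑ k ∈ window N, (‖e k‖ ^ 2 - s k)) hκ hκ' ht ht' hb hr1 hr1' hr2' hr2
      (hsw M) hsI hT (by rw [hww]; linarith) hX hX' hW1 hW2 hE
    rw [sum_window_add_gap h fun k => ‖u k + e k - θ k‖ ^ 2 - ‖θ k‖ ^ 2, ← hG, exp2]
    -- The bias between `M` and the random `N` is at most the bias between `M` and `m`, which no
    -- longer depends on `N`.
    have hbm : ∑ k ∈ G, ‖θ k‖ ^ 2 ≤ ∑ k ∈ gap M m, ‖θ k‖ ^ 2 := by
      rw [hG, hgm h, hgm hM]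
      linarith [hmm (fun k => ‖θ k‖ ^ 2) (fun _ => by positivity) hN]
    have := mul_le_mul_of_nonneg_left hbm (add_nonneg ht hκ)
    rw [hww] at key
    constructor
    · nlinarith [key.1]
    · linarith [key.2]
  · rw [max_eq_left h, sum_window_add_gap h s, gap_comm N M] at hX hX'
    have hW1 := hW N hN
    have hW2 := hW M hM
    rw [sum_window_add_gap h s, gap_comm N M] at hW2
    have hww := sum_window_add_gap h fun k => ‖e k‖ ^ 2 - s k
    rw [sum_window_add_gap h, gap_comm N M, ← hG, exp1] at hcrit
    rw [gap_comm N M] at hww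
    have hT : ∑ k ∈ window N, s k + ∑ k ∈ G, s k ≤ ∑ k ∈ window m, s k := by
      rw [hG, gap_comm M N, ← sum_window_add_gap h]; exact hmm s hs hM
    have key := excess_le_of_below (W₁ := ∑ k ∈ window N, (‖e k‖ ^ 2 - s k))
      (W₂ := ∑ k ∈ window M, (‖e k‖ ^ 2 - s k)) (B := ∑ k ∈ gap M m, ‖θ k‖ ^ 2)
      hκ hκ' ht ht' hb hr1 hr1' hr2' hr3
      (hsw N) hsI hT (Finset.sum_nonneg fun _ _ => by positivity)
      (by rw [hww]; linarith) hX hX' hW1 hW2 hE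
    rw [sum_window_add_gap h fun k => ‖u k + e k - θ k‖ ^ 2 - ‖θ k‖ ^ 2, gap_comm N M, ← hG, exp2,
      sum_window_add_gap h s, gap_comm N M]
    rw [hww] at key
    constructor
    · linarith [key.1]
    · linarith [key.2]

/-! ### Exponential and second moments of the standard complex Gaussian law. -/

section Gaussian

lemma measurable_complex_mk :
    Measurable (fun p : ℝ × ℝ => (p.1 : ℂ) + (p.2 : ℂ) * Complex.I) := by fun_prop

instance : IsProbabilityMeasure stdComplexGaussian :=
  Measure.isProbabilityMeasure_map measurable_complex_mk.aemeasurable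

lemma lintegral_stdComplexGaussian {F : ℂ → ℝ≥0∞} (hF : Measurable F) :
    ∫⁻ z, F z ∂stdComplexGaussian =
      ∫⁻ x, ∫⁻ y, F ((x : ℂ) + (y : ℂ) * Complex.I) ∂(gaussianReal 0 (1 / 2))
        ∂(gaussianReal 0 (1 / 2)) := by
  rw [stdComplexGaussian, lintegral_map hF measurable_complex_mk]
  exact lintegral_prod _ (hF.comp measurable_complex_mk).aemeasurable

lemma lintegral_stdComplexGaussian_mul {F : ℂ → ℝ≥0∞} {G H : ℝ → ℝ≥0∞} (hF : Measurable F)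
    (hG : Measurable G) (hH : Measurable H)
    (h : ∀ x y : ℝ, F ((x : ℂ) + (y : ℂ) * Complex.I) = G x * H y) :
    ∫⁻ z, F z ∂stdComplexGaussian =
      (∫⁻ x, G x ∂(gaussianReal 0 (1 / 2))) * ∫⁻ y, H y ∂(gaussianReal 0 (1 / 2)) := by
  rw [lintegral_stdComplexGaussian hF]
  simp_rw [h]
  rw [← lintegral_mul_const _ hG]
  exact lintegral_congr fun x => lintegral_const_mul _ hH

lemma lintegral_exp_mul_gaussian (t : ℝ) :
    ∫⁻ x, ENNReal.ofReal (Real.exp (t * x)) ∂(gaussianReal 0 (1 / 2)) =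
      ENNReal.ofReal (Real.exp (t ^ 2 / 4)) := by
  rw [← ofReal_integral_eq_lintegral_ofReal (integrable_exp_mul_gaussianReal t)
    (ae_of_all _ fun _ => (Real.exp_pos _).le)]
  have := congr_fun (mgf_fun_id_gaussianReal (μ := 0) (v := 1 / 2)) t
  rw [mgf] at this
  rw [this]
  congr 2
  push_cast
  ring

lemma lintegral_exp_inner_stdComplexGaussian (d : ℂ) :
    ∫⁻ z, ENNReal.ofReal (Real.exp (inner ℝ d z)) ∂stdComplexGaussian =
      ENNReal.ofReal (Real.exp (‖d‖ ^ 2 / 4)) := by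
  rw [lintegral_stdComplexGaussian_mul
    (G := fun x => ENNReal.ofReal (Real.exp (d.re * x)))
    (H := fun y => ENNReal.ofReal (Real.exp (d.im * y))) (by fun_prop) (by fun_prop)
    (by fun_prop), lintegral_exp_mul_gaussian, lintegral_exp_mul_gaussian,
    ← ENNReal.ofReal_mul (Real.exp_pos _).le, ← Real.exp_add, Complex.sq_norm,
    Complex.normSq_apply]
  · congr 2; ring
  · intro x y
    rw [← ENNReal.ofReal_mul (Real.exp_pos _).le, ← Real.exp_add]
    congr 2
    simp [Complex.inner]
    ring

lemma lintegral_gaussian_half {F : ℝ → ℝ≥0∞} (hF : Measurable F) :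
    ∫⁻ x, F x ∂(gaussianReal 0 (1 / 2)) =
      ∫⁻ x, ENNReal.ofReal ((√Real.pi)⁻¹ * Real.exp (-x ^ 2)) * F x := by
  rw [gaussianReal_of_var_ne_zero _ (by norm_num),
    lintegral_withDensity_eq_lintegral_mul _ (measurable_gaussianPDF _ _) hF]
  refine lintegral_congr fun x => ?_
  rw [Pi.mul_apply, gaussianPDF_def, gaussianPDFReal_def]
  congr 2
  have h : (((1 / 2 : NNReal)) : ℝ) = 1 / 2 := by norm_num
  simp only [h, sub_zero]
  congr 3
  · congr 1; ring
  · ring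

lemma lintegral_exp_sq_gaussian {s : ℝ} (hs : s < 1) :
    ∫⁻ x, ENNReal.ofReal (Real.exp (s * x ^ 2)) ∂(gaussianReal 0 (1 / 2)) =
      ENNReal.ofReal ((√(1 - s))⁻¹) := by
  rw [lintegral_gaussian_half (by fun_prop)]
  have h : ∀ x : ℝ, ENNReal.ofReal ((√Real.pi)⁻¹ * Real.exp (-x ^ 2)) *
      ENNReal.ofReal (Real.exp (s * x ^ 2)) =
      ENNReal.ofReal ((√Real.pi)⁻¹ * Real.exp (-(1 - s) * x ^ 2)) := fun x => by
    rw [← ENNReal.ofReal_mul (by positivity), mul_assoc, ← Real.exp_add]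
    congr 3; ring
  simp_rw [h]
  rw [← ofReal_integral_eq_lintegral_ofReal
    ((integrable_exp_neg_mul_sq (by linarith)).const_mul _)
    (ae_of_all _ fun _ => by positivity), integral_const_mul, integral_gaussian,
    Real.sqrt_div Real.pi_pos.le]
  congr 1
  have := Real.sqrt_pos.2 Real.pi_pos
  field_simp

/-- This is `-s - log (1 - s) ≤ s²` near `0`. It follows from Taylor lower bounds of `exp (s + s²)`:
to second order for `s ≥ 0`, while the first order suffices for `s ≤ 0`. -/
lemma exp_neg_div_one_sub_le {s : ℝ} (hs : |s| ≤ 1 / 2) :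
    Real.exp (-s) * (1 - s)⁻¹ ≤ Real.exp (s ^ 2) := by
  rw [abs_le] at hs
  have h1 : 0 < 1 - s := by linarith
  rw [← div_eq_mul_inv, div_le_iff₀ h1, Real.exp_neg, inv_le_iff_one_le_mul₀ (Real.exp_pos _)]
  have h2 : Real.exp (s ^ 2) * (1 - s) * Real.exp s = (1 - s) * Real.exp (s + s ^ 2) := by
    rw [Real.exp_add]; ring
  rw [h2]
  rcases le_total 0 s with h | h
  · have := Real.quadratic_le_exp_of_nonneg (x := s + s ^ 2) (by positivity)
    have h3 : (1 - s) * (1 + (s + s ^ 2) + (s + s ^ 2) ^ 2 / 2) ≤ (1 - s) * Real.exp (s + s ^ 2) :=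
      mul_le_mul_of_nonneg_left this h1.le
    -- The left side of `h3` equals `1 + s² ((1 - s)(1 + s)² / 2 - s)` exactly.
    have h4 : 0 ≤ s ^ 2 * ((1 - s) * (1 + s) ^ 2 / 2 - s) := by
      apply mul_nonneg (sq_nonneg _)
      nlinarith
    nlinarith
  · have := Real.add_one_le_exp (s + s ^ 2)
    have h3 : (1 - s) * (s + s ^ 2 + 1) ≤ (1 - s) * Real.exp (s + s ^ 2) :=
      mul_le_mul_of_nonneg_left this h1.le
    nlinarith [mul_nonneg (sq_nonneg s) (neg_nonneg.2 h)]

/-- Each coordinate contributes `(1 - s)^(-1/2)`, so `‖z‖²` has the exponential moment `(1 - s)⁻¹`;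
centring adds the factor `exp (-s)`. -/
lemma lintegral_exp_normSq_stdComplexGaussian {s : ℝ} (hs : |s| ≤ 1 / 2) :
    ∫⁻ z, ENNReal.ofReal (Real.exp (s * (‖z‖ ^ 2 - 1))) ∂stdComplexGaussian ≤
      ENNReal.ofReal (Real.exp (s ^ 2)) := by
  have hs1 : s < 1 := by linarith [le_abs_self s]
  rw [lintegral_stdComplexGaussian_mul
    (G := fun x => ENNReal.ofReal (Real.exp (-s)) * ENNReal.ofReal (Real.exp (s * x ^ 2)))
    (H := fun y => ENNReal.ofReal (Real.exp (s * y ^ 2))) (by fun_prop) (by fun_prop)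
    (by fun_prop), lintegral_const_mul _ (by fun_prop), lintegral_exp_sq_gaussian hs1,
    mul_assoc, ← ENNReal.ofReal_mul (by positivity), ← ENNReal.ofReal_mul (Real.exp_pos _).le,
    ← mul_inv, Real.mul_self_sqrt (by linarith)]
  · exact ENNReal.ofReal_le_ofReal (exp_neg_div_one_sub_le hs)
  · intro x y
    rw [← ENNReal.ofReal_mul (Real.exp_pos _).le, ← ENNReal.ofReal_mul (by positivity),
      ← Real.exp_add, ← Real.exp_add, Complex.sq_norm, Complex.normSq_apply]
    congr 2
    simp
    ring

lemma lintegral_sq_gaussian :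
    ∫⁻ x, ENNReal.ofReal (x ^ 2) ∂(gaussianReal 0 (1 / 2)) = ENNReal.ofReal (1 / 2) := by
  have h := variance_fun_id_gaussianReal (μ := 0) (v := 1 / 2)
  rw [variance_of_integral_eq_zero (by fun_prop) (by simp)] at h
  rw [← ofReal_integral_eq_lintegral_ofReal, h]
  · norm_num
  · exact (memLp_id_gaussianReal (μ := 0) (v := 1 / 2) 2).integrable_sq
  · exact ae_of_all _ fun _ => sq_nonneg _

lemma lintegral_normSq_stdComplexGaussian :
    ∫⁻ z, ENNReal.ofReal (‖z‖ ^ 2) ∂stdComplexGaussian = 1 := by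
  rw [lintegral_stdComplexGaussian (by fun_prop)]
  have h : ∀ x y : ℝ, ENNReal.ofReal (‖(x : ℂ) + (y : ℂ) * Complex.I‖ ^ 2) =
      ENNReal.ofReal (x ^ 2) + ENNReal.ofReal (y ^ 2) := fun x y => by
    rw [← ENNReal.ofReal_add (sq_nonneg _) (sq_nonneg _), Complex.sq_norm, Complex.normSq_apply]
    congr 1
    simp
    ring
  simp_rw [h]
  simp_rw [lintegral_add_left (measurable_const), lintegral_const, lintegral_sq_gaussian]
  rw [lintegral_add_right _ measurable_const, lintegral_mul_const _ (by fun_prop),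
    lintegral_sq_gaussian, lintegral_const]
  simp only [measure_univ, mul_one]
  rw [← ENNReal.ofReal_add (by norm_num) (by norm_num)]
  norm_num

lemma lintegral_gaussian_neg {F : ℝ → ℝ≥0∞} (hF : Measurable F) :
    ∫⁻ x, F (-x) ∂(gaussianReal 0 (1 / 2)) = ∫⁻ x, F x ∂(gaussianReal 0 (1 / 2)) := by
  have h := gaussianReal_map_neg (μ := 0) (v := 1 / 2)
  rw [neg_zero] at h
  conv_rhs => rw [← h]
  rw [lintegral_map hF (by fun_prop)]

lemma lintegral_stdComplexGaussian_neg {F : ℂ → ℝ≥0∞} (hF : Measurable F) :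
    ∫⁻ z, F (-z) ∂stdComplexGaussian = ∫⁻ z, F z ∂stdComplexGaussian := by
  rw [lintegral_stdComplexGaussian (F := fun z => F (-z)) (hF.comp measurable_neg),
    lintegral_stdComplexGaussian hF]
  rw [← lintegral_gaussian_neg (F := fun x => ∫⁻ y, F ((x : ℂ) + (y : ℂ) * Complex.I)
    ∂(gaussianReal 0 (1 / 2)))]
  · refine lintegral_congr fun x => ?_
    rw [← lintegral_gaussian_neg]
    · refine lintegral_congr fun y => ?_
      congr 1
      push_cast
      ring
    · exact hF.comp (by fun_prop)
  · exact (hF.comp measurable_complex_mk).lintegral_prod_right'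

/-- Averaging over `z` and `-z`, the parallelogram law removes the cross term, so no integrability
of it is needed. -/
lemma lintegral_normSq_add_stdComplexGaussian (c w : ℂ) :
    ∫⁻ z, ENNReal.ofReal (‖c + w * z‖ ^ 2) ∂stdComplexGaussian =
      ENNReal.ofReal (‖c‖ ^ 2 + ‖w‖ ^ 2) := by
  have hm : Measurable fun z : ℂ => ENNReal.ofReal (‖c + w * z‖ ^ 2) := by fun_prop
  have h1 : 2 * ∫⁻ z, ENNReal.ofReal (‖c + w * z‖ ^ 2) ∂stdComplexGaussian =
      2 * ENNReal.ofReal (‖c‖ ^ 2 + ‖w‖ ^ 2) := by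
    rw [two_mul]
    nth_rewrite 2 [← lintegral_stdComplexGaussian_neg hm]
    rw [← lintegral_add_left hm]
    have h : ∀ z : ℂ, ENNReal.ofReal (‖c + w * z‖ ^ 2) + ENNReal.ofReal (‖c + w * -z‖ ^ 2) =
        2 * (ENNReal.ofReal (‖c‖ ^ 2) + ENNReal.ofReal (‖w‖ ^ 2) * ENNReal.ofReal (‖z‖ ^ 2)) :=
      fun z => by
      rw [← ENNReal.ofReal_add (by positivity) (by positivity),
        ← ENNReal.ofReal_mul (by positivity), ← ENNReal.ofReal_add (by positivity) (by positivity),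
        ← ENNReal.ofReal_ofNat 2, ← ENNReal.ofReal_mul (by norm_num)]
      congr 1
      have := parallelogram_law_with_norm ℝ c (w * z)
      rw [norm_mul] at this
      rw [mul_neg, ← sub_eq_add_neg]
      linarith
    simp_rw [h]
    rw [lintegral_const_mul _ (by fun_prop), lintegral_add_left measurable_const,
      lintegral_const_mul _ (by fun_prop), lintegral_normSq_stdComplexGaussian, lintegral_const,
      measure_univ, mul_one, mul_one, ENNReal.ofReal_add (by positivity) (by positivity)]
  exact (ENNReal.mul_right_inj (by norm_num) (by norm_num)).1 h1

lemma charFun_stdComplexGaussian (t : ℂ) :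
    charFun stdComplexGaussian t = Complex.exp (-(‖t‖ ^ 2 / 4 : ℝ)) := by
  rw [charFun_apply, stdComplexGaussian, integral_map measurable_complex_mk.aemeasurable
    (by fun_prop)]
  have h : ∀ p : ℝ × ℝ, Complex.exp ((inner ℝ ((p.1 : ℂ) + (p.2 : ℂ) * Complex.I) t : ℝ) *
      Complex.I) = Complex.exp (t.re * p.1 * Complex.I) * Complex.exp (t.im * p.2 * Complex.I) :=
    fun p => by
    rw [← Complex.exp_add]
    congr 1
    simp [Complex.inner]
    ring
  simp_rw [h]
  rw [integral_prod_mul (fun x : ℝ => Complex.exp (t.re * x * Complex.I))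
    (fun y : ℝ => Complex.exp (t.im * y * Complex.I))]
  rw [← charFun_apply_real, ← charFun_apply_real, charFun_gaussianReal, charFun_gaussianReal,
    ← Complex.exp_add]
  congr 1
  rw [Complex.sq_norm, Complex.normSq_apply]
  push_cast
  ring

end Gaussian

/-! ### Law and independence of the averaged noise; separation of shifts and noise. -/

section Noise

/-- Independence of the blocks of a doubly indexed independent family. -/
lemma iIndepFun_blocks {Ω ι κ E : Type*} [MeasurableSpace Ω] {μ : Measure Ω}
    [MeasurableSpace E] {X : ι → κ → Ω → E} (mX : ∀ i j, Measurable (X i j))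
    (h : iIndepFun (fun p : ι × κ => X p.1 p.2) μ) :
    iIndepFun (fun i ω j => X i j ω) μ := by
  have := h.isProbabilityMeasure
  have hp : ∀ i j, IsProbabilityMeasure (μ.map (X i j)) :=
    fun i j => Measure.isProbabilityMeasure_map (mX i j).aemeasurable
  have h1 : iIndepFun (fun (p : (_ : ι) × κ) ω => X p.1 p.2 ω) μ :=
    h.precomp (Equiv.sigmaEquivProd ι κ).injective
  have h2 : ∀ i, iIndepFun (X i) μ := fun i =>
    h.precomp (g := fun j => (i, j)) fun a b hab => (Prod.ext_iff.1 hab).2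
  rw [iIndepFun_iff_map_fun_eq_infinitePi_map (by fun_prop)]
  -- Currying the index carries the product measure over pairs to a product of products, which is
  -- independence of the blocks.
  have h3 : (MeasurableEquiv.piCurry (fun (_ : ι) (_ : κ) => E)) ∘ (fun ω p => X p.1 p.2 ω) =
      fun ω i j => X i j ω := by
    ext; simp [Sigma.curry]
  rw [← h3, ← Measure.map_map (by fun_prop) (by fun_prop),
    (iIndepFun_iff_map_fun_eq_infinitePi_map (by fun_prop)).1 h1,
    Measure.infinitePi_map_piCurry (fun i j => μ.map (X i j))]
  congrm Measure.infinitePi fun i => ?_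
  rw [(iIndepFun_iff_map_fun_eq_infinitePi_map (by fun_prop)).1 (h2 i)]

/-- The averaged noise, rescaled to unit variance. -/
def normalizedNoise {Ω : Type*} {n : ℕ} (z : ℤ → Fin n → Ω → ℂ) (k : ℤ) (ω : Ω) : ℂ :=
  ((√(n : ℝ) : ℝ) : ℂ)⁻¹ * ∑ j, z k j ω

variable {Ω : Type*} [MeasurableSpace Ω] {μ : Measure Ω} {g : ℝ → ℝ} {n : ℕ}
  {τ : Fin n → Ω → ℝ} {z : ℤ → Fin n → Ω → ℂ}

lemma IsShiftModel.measurable_normalizedNoise (h : IsShiftModel μ g τ z) (k : ℤ) :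
    Measurable (normalizedNoise z k) := by
  have := h.measurable_noise
  unfold normalizedNoise
  fun_prop

/-- The `n`-th power of the characteristic function at `t / √n` is the characteristic function at
`t`. -/
lemma IsShiftModel.map_normalizedNoise (h : IsShiftModel μ g τ z) (hn : 0 < n) (k : ℤ) :
    μ.map (normalizedNoise z k) = stdComplexGaussian := by
  have := h.indep_noise.isProbabilityMeasure
  have hm := h.measurable_noise k
  have hk : iIndepFun (z k) μ :=
    h.indep_noise.precomp (g := fun j => (k, j)) fun a b hab => (Prod.ext_iff.1 hab).2
  have : IsFiniteMeasure (μ.map (normalizedNoise z k)) := by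
    have := Measure.isProbabilityMeasure_map (μ := μ) (h.measurable_normalizedNoise k).aemeasurable
    infer_instance
  have hc : normalizedNoise z k =
      (fun x => (√(n : ℝ))⁻¹ • x) ∘ fun ω => ∑ j, z k j ω := by
    funext ω
    simp [normalizedNoise, Complex.real_smul]
  refine Measure.ext_of_charFun ?_
  ext t
  rw [hc, ← Measure.map_map (by fun_prop) (by fun_prop), charFun_map_smul,
    hk.charFun_map_fun_sum_eq_prod fun j => (hm j).aemeasurable]
  simp_rw [h.law_noise]
  rw [Finset.prod_const, Finset.card_univ, Fintype.card_fin, Pi.pow_apply,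
    charFun_stdComplexGaussian, charFun_stdComplexGaussian, ← Complex.exp_nat_mul]
  congr 1
  rw [norm_smul, mul_pow, norm_inv, inv_pow, Real.norm_of_nonneg (Real.sqrt_nonneg _),
    Real.sq_sqrt (Nat.cast_nonneg _)]
  have : (n : ℂ) ≠ 0 := by exact_mod_cast hn.ne'
  push_cast
  field_simp

lemma IsShiftModel.iIndepFun_normalizedNoise (h : IsShiftModel μ g τ z) :
    iIndepFun (normalizedNoise z) μ := by
  have := (iIndepFun_blocks h.measurable_noise h.indep_noise).comp
    (fun _ (x : Fin n → ℂ) => ((√(n : ℝ) : ℝ) : ℂ)⁻¹ * ∑ j, x j) (fun _ => by fun_prop)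
  exact this

lemma IsShiftModel.indepFun_normalizedNoise (h : IsShiftModel μ g τ z) :
    IndepFun (fun ω (j : Fin n) => τ j ω) (fun ω k => normalizedNoise z k ω) μ := by
  have := h.indep_shift_noise.comp (φ := id)
    (ψ := fun (x : ℤ × Fin n → ℂ) (k : ℤ) => ((√(n : ℝ) : ℝ) : ℂ)⁻¹ * ∑ j, x (k, j))
    measurable_id (by fun_prop)
  exact this

/-- Integration of a function of the shifts and of the noise. -/
lemma IsShiftModel.lintegral_shift_noise [IsProbabilityMeasure μ] (h : IsShiftModel μ g τ z)
    {F : (Fin n → ℝ) → (ℤ → ℂ) → ℝ≥0∞} (hF : Measurable (Function.uncurry F)) :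
    ∫⁻ ω, F (fun j => τ j ω) (fun k => normalizedNoise z k ω) ∂μ =
      ∫⁻ ω, ∫⁻ ω', F (fun j => τ j ω) (fun k => normalizedNoise z k ω') ∂μ ∂μ := by
  have hm1 : Measurable fun ω (j : Fin n) => τ j ω := measurable_pi_lambda _ h.measurable_shift
  have hm2 : Measurable fun ω k => normalizedNoise z k ω :=
    measurable_pi_lambda _ h.measurable_normalizedNoise
  have h1 := (indepFun_iff_map_prod_eq_prod_map_map hm1.aemeasurable hm2.aemeasurable).1
    h.indepFun_normalizedNoise
  have := Measure.isProbabilityMeasure_map (μ := μ) hm1.aemeasurable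
  have := Measure.isProbabilityMeasure_map (μ := μ) hm2.aemeasurable
  calc _ = ∫⁻ p, Function.uncurry F p
        ∂(μ.map fun ω => ((fun (j : Fin n) => τ j ω), fun k => normalizedNoise z k ω)) := by
        rw [lintegral_map hF (hm1.prodMk hm2)]; rfl
    _ = _ := by
        rw [h1, lintegral_prod _ hF.aemeasurable, lintegral_map _ hm1]
        · refine lintegral_congr fun ω => ?_
          rw [lintegral_map _ hm2]
          · rfl
          · exact hF.comp measurable_prodMk_left
        · exact hF.lintegral_prod_right'

lemma IsShiftModel.lintegral_comp_normalizedNoise (h : IsShiftModel μ g τ z) (hn : 0 < n) (k : ℤ)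
    {F : ℂ → ℝ≥0∞} (hF : Measurable F) :
    ∫⁻ ω, F (normalizedNoise z k ω) ∂μ = ∫⁻ x, F x ∂stdComplexGaussian := by
  rw [← h.map_normalizedNoise hn k, lintegral_map hF (h.measurable_normalizedNoise k)]

lemma IsShiftModel.lintegral_exp_inner (h : IsShiftModel μ g τ z) (hn : 0 < n) (I : Finset ℤ)
    (d : ℤ → ℂ) :
    ∫⁻ ω, ENNReal.ofReal (Real.exp (∑ k ∈ I, inner ℝ (d k) (normalizedNoise z k ω))) ∂μ =
      ENNReal.ofReal (Real.exp (∑ k ∈ I, ‖d k‖ ^ 2 / 4)) := by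
  simp_rw [Real.exp_sum, ENNReal.ofReal_prod_of_nonneg fun _ _ => (Real.exp_pos _).le]
  have hi := h.iIndepFun_normalizedNoise.comp
    (fun k x => ENNReal.ofReal (Real.exp (inner ℝ (d k) x))) (fun k => by fun_prop)
  have hm := h.measurable_normalizedNoise
  rw [lintegral_prod_eq_prod_lintegral_of_indepFun I
    (fun k ω => ENNReal.ofReal (Real.exp (inner ℝ (d k) (normalizedNoise z k ω)))) hi
    (fun k => by fun_prop)]
  refine Finset.prod_congr rfl fun k _ => ?_
  rw [h.lintegral_comp_normalizedNoise hn k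
    (F := fun x => ENNReal.ofReal (Real.exp (inner ℝ (d k) x))) (by fun_prop),
    lintegral_exp_inner_stdComplexGaussian]

lemma IsShiftModel.lintegral_exp_normSq_le (h : IsShiftModel μ g τ z) (hn : 0 < n) (I : Finset ℤ)
    (d : ℤ → ℝ) (hd : ∀ k ∈ I, |d k| ≤ 1 / 2) :
    ∫⁻ ω, ENNReal.ofReal (Real.exp (∑ k ∈ I, d k * (‖normalizedNoise z k ω‖ ^ 2 - 1))) ∂μ ≤
      ENNReal.ofReal (Real.exp (∑ k ∈ I, d k ^ 2)) := by
  simp_rw [Real.exp_sum, ENNReal.ofReal_prod_of_nonneg fun _ _ => (Real.exp_pos _).le]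
  have hi := h.iIndepFun_normalizedNoise.comp
    (fun k x => ENNReal.ofReal (Real.exp (d k * (‖x‖ ^ 2 - 1)))) (fun k => by fun_prop)
  have hm := h.measurable_normalizedNoise
  rw [lintegral_prod_eq_prod_lintegral_of_indepFun I
    (fun k ω => ENNReal.ofReal (Real.exp (d k * (‖normalizedNoise z k ω‖ ^ 2 - 1)))) hi
    (fun k => by fun_prop)]
  refine Finset.prod_le_prod' fun k hk => ?_
  rw [h.lintegral_comp_normalizedNoise hn k
    (F := fun x => ENNReal.ofReal (Real.exp (d k * (‖x‖ ^ 2 - 1)))) (by fun_prop)]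
  exact lintegral_exp_normSq_stdComplexGaussian (hd k hk)

end Noise

/-! ### Chernoff bounds for linear and quadratic forms of the noise. -/

section Deviations

/-- Expected overshoot of `|Y|` above a level, from a bound on exponential moments. -/
lemma lintegral_overshoot_le {Ω : Type*} [MeasurableSpace Ω] {μ : Measure Ω} {Y : Ω → ℝ}
    (hY : Measurable Y) {s V T : ℝ} (hs : 0 < s)
    (h1 : ∫⁻ ω, ENNReal.ofReal (Real.exp (s * Y ω)) ∂μ ≤ ENNReal.ofReal (Real.exp V))
    (h2 : ∫⁻ ω, ENNReal.ofReal (Real.exp (-s * Y ω)) ∂μ ≤ ENNReal.ofReal (Real.exp V)) :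
    ∫⁻ ω, ENNReal.ofReal (|Y ω| - T) ∂μ ≤ ENNReal.ofReal (2 / s * Real.exp (V - s * T)) := by
  -- The inequality `y ≤ exp y` with `y = s(|Y| - T)` bounds the expected overshoot directly,
  -- without integrating tail probabilities.
  have key : ∀ ω, ENNReal.ofReal (|Y ω| - T) ≤ ENNReal.ofReal (1 / s * Real.exp (-(s * T))) *
      (ENNReal.ofReal (Real.exp (s * Y ω)) + ENNReal.ofReal (Real.exp (-s * Y ω))) := fun ω => by
    rw [← ENNReal.ofReal_add (Real.exp_pos _).le (Real.exp_pos _).le,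
      ← ENNReal.ofReal_mul (by positivity)]
    refine ENNReal.ofReal_le_ofReal ?_
    have h3 : s * (|Y ω| - T) ≤ Real.exp (s * (|Y ω| - T)) := by
      linarith [Real.add_one_le_exp (s * (|Y ω| - T))]
    have h4 : Real.exp (s * |Y ω|) ≤ Real.exp (s * Y ω) + Real.exp (-s * Y ω) := by
      rcases abs_cases (Y ω) with h | h
      · rw [h.1]; linarith [Real.exp_pos (-s * Y ω)]
      · rw [h.1, mul_neg, ← neg_mul]; linarith [Real.exp_pos (s * Y ω)]
    calc |Y ω| - T = 1 / s * (s * (|Y ω| - T)) := by field_simp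
      _ ≤ 1 / s * Real.exp (s * (|Y ω| - T)) := by gcongr
      _ = 1 / s * Real.exp (-(s * T)) * Real.exp (s * |Y ω|) := by
        rw [mul_assoc, ← Real.exp_add]; congr 2; ring
      _ ≤ _ := by gcongr
  calc _ ≤ ∫⁻ ω, ENNReal.ofReal (1 / s * Real.exp (-(s * T))) *
      (ENNReal.ofReal (Real.exp (s * Y ω)) + ENNReal.ofReal (Real.exp (-s * Y ω))) ∂μ :=
        lintegral_mono key
    _ ≤ ENNReal.ofReal (1 / s * Real.exp (-(s * T))) *
      (ENNReal.ofReal (Real.exp V) + ENNReal.ofReal (Real.exp V)) := by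
        rw [lintegral_const_mul _ (by fun_prop), lintegral_add_left (by fun_prop)]
        gcongr
    _ = _ := by
        rw [← ENNReal.ofReal_add (Real.exp_pos _).le (Real.exp_pos _).le,
          ← ENNReal.ofReal_mul (by positivity), sub_eq_add_neg, Real.exp_add]
        congr 1; ring

variable {Ω : Type*} [MeasurableSpace Ω] {μ : Measure Ω} {g : ℝ → ℝ} {n : ℕ}
  {τ : Fin n → Ω → ℝ} {z : ℤ → Fin n → Ω → ℂ}

/-- With exponent `κ / D`, the Gaussian variance term is at most `(κ / D) κ ∑ ‖c k‖²`, exactly what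
the first part of the compensator cancels. The free part `κ * S` then gives the decay, uniformly in
`c`. -/
lemma IsShiftModel.lintegral_linear_overshoot_le (h : IsShiftModel μ g τ z) (hn : 0 < n)
    {w : ℤ → ℂ} {D κ S : ℝ} (hD : 0 < D) (hκ : 0 < κ) {I : Finset ℤ}
    (hw : ∀ k ∈ I, ‖w k‖ ^ 2 ≤ D) (c : ℤ → ℂ) :
    ∫⁻ ω, ENNReal.ofReal (|∑ k ∈ I, inner ℝ (c k) (w k * normalizedNoise z k ω)| -
        (κ * ∑ k ∈ I, ‖c k‖ ^ 2 + κ * S)) ∂μ ≤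
      ENNReal.ofReal (2 * D / κ * Real.exp (-(κ ^ 2 * S / D))) := by
  have hm := h.measurable_normalizedNoise
  have hs : 0 < κ / D := by positivity
  have hexp : ∀ s : ℝ, |s| ≤ κ / D →
      ∫⁻ ω, ENNReal.ofReal (Real.exp (s * ∑ k ∈ I, inner ℝ (c k) (w k * normalizedNoise z k ω)))
        ∂μ ≤ ENNReal.ofReal (Real.exp ((κ / D) * (κ * ∑ k ∈ I, ‖c k‖ ^ 2))) := fun s hsD => by
    have hr : ∀ ω, s * ∑ k ∈ I, inner ℝ (c k) (w k * normalizedNoise z k ω) =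
        ∑ k ∈ I, inner ℝ ((s : ℂ) * (starRingEnd ℂ (w k) * c k)) (normalizedNoise z k ω) :=
      fun ω => by
      rw [Finset.mul_sum]
      refine Finset.sum_congr rfl fun k _ => ?_
      simp [Complex.inner]
      ring
    simp_rw [hr]
    rw [h.lintegral_exp_inner hn]
    refine ENNReal.ofReal_le_ofReal (Real.exp_le_exp.2 ?_)
    rw [← mul_assoc, Finset.mul_sum]
    refine Finset.sum_le_sum fun k hk => ?_
    rw [norm_mul, norm_mul, Complex.norm_real, RCLike.norm_conj, mul_pow, mul_pow,
      Real.norm_eq_abs]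
    have h1 : |s| ^ 2 ≤ (κ / D) ^ 2 := pow_le_pow_left₀ (abs_nonneg _) hsD 2
    calc |s| ^ 2 * (‖w k‖ ^ 2 * ‖c k‖ ^ 2) / 4 ≤ (κ / D) ^ 2 * (D * ‖c k‖ ^ 2) / 4 := by
          gcongr; exact hw k hk
      _ = κ / D * κ * ‖c k‖ ^ 2 / 4 := by field_simp
      _ ≤ κ / D * κ * ‖c k‖ ^ 2 := by
          have : 0 ≤ κ / D * κ * ‖c k‖ ^ 2 := by positivity
          linarith
  refine (lintegral_overshoot_le (by fun_prop) hs (hexp _ (abs_of_pos hs).le)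
    (hexp _ (by rw [abs_neg, abs_of_pos hs]))).trans (le_of_eq ?_)
  congr 1
  congr 1
  · field_simp
  · congr 1; field_simp; ring

/-- The exponent `κ / (2D)` keeps each `s ‖w k‖²` within `1 / 2`, the range of the centred
exponential moment bound; half of the compensator then pays for the variance term. -/
lemma IsShiftModel.lintegral_quadratic_overshoot_le (h : IsShiftModel μ g τ z) (hn : 0 < n)
    {w : ℤ → ℂ} {D κ : ℝ} (hD : 0 < D) (hκ : 0 < κ) (hκ' : κ ≤ 1) {I : Finset ℤ}
    (hw : ∀ k ∈ I, ‖w k‖ ^ 2 ≤ D) :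
    ∫⁻ ω, ENNReal.ofReal (|∑ k ∈ I, (‖w k * normalizedNoise z k ω‖ ^ 2 - ‖w k‖ ^ 2)| -
        κ * ∑ k ∈ I, ‖w k‖ ^ 2) ∂μ ≤
      ENNReal.ofReal (4 * D / κ * Real.exp (-(κ ^ 2 * (∑ k ∈ I, ‖w k‖ ^ 2) / (4 * D)))) := by
  have hm := h.measurable_normalizedNoise
  have hs : 0 < κ / (2 * D) := by positivity
  have hexp : ∀ s : ℝ, |s| = κ / (2 * D) →
      ∫⁻ ω, ENNReal.ofReal (Real.exp (s * ∑ k ∈ I,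
        (‖w k * normalizedNoise z k ω‖ ^ 2 - ‖w k‖ ^ 2))) ∂μ ≤
        ENNReal.ofReal (Real.exp (κ ^ 2 / (4 * D) * ∑ k ∈ I, ‖w k‖ ^ 2)) := fun s hsD => by
    have hr : ∀ ω, s * ∑ k ∈ I, (‖w k * normalizedNoise z k ω‖ ^ 2 - ‖w k‖ ^ 2) =
        ∑ k ∈ I, (s * ‖w k‖ ^ 2) * (‖normalizedNoise z k ω‖ ^ 2 - 1) := fun ω => by
      rw [Finset.mul_sum]
      refine Finset.sum_congr rfl fun k _ => ?_
      rw [norm_mul]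
      ring
    simp_rw [hr]
    refine (h.lintegral_exp_normSq_le hn I _ fun k hk => ?_).trans ?_
    · rw [abs_mul, hsD, abs_of_nonneg (by positivity : 0 ≤ ‖w k‖ ^ 2)]
      calc κ / (2 * D) * ‖w k‖ ^ 2 ≤ 1 / (2 * D) * D := by gcongr; exact hw k hk
        _ = 1 / 2 := by field_simp
    · refine ENNReal.ofReal_le_ofReal (Real.exp_le_exp.2 ?_)
      rw [Finset.mul_sum]
      refine Finset.sum_le_sum fun k hk => ?_
      calc (s * ‖w k‖ ^ 2) ^ 2 = |s| ^ 2 * (‖w k‖ ^ 2 * ‖w k‖ ^ 2) := by rw [sq_abs]; ring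
        _ ≤ (κ / (2 * D)) ^ 2 * (D * ‖w k‖ ^ 2) := by rw [hsD]; gcongr; exact hw k hk
        _ = _ := by field_simp; ring
  refine (lintegral_overshoot_le (by fun_prop) hs (hexp _ (abs_of_pos hs))
    (hexp _ (by rw [abs_neg, abs_of_pos hs]))).trans (le_of_eq ?_)
  congr 1
  congr 1
  · field_simp; ring
  · congr 1; field_simp; ring

/-- Exponential decay along the cut-offs beats the polynomial growth of the weights. -/
lemma mul_exp_neg_le_of_poly {c C κ σ D S : ℝ} {r M : ℕ} (hc : 0 < c) (hC : 0 < C) (hκ : 0 < κ)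
    (hD : 0 < D) (hS : c * (M + 1) ≤ S / D) (hDC : D ≤ σ ^ 2 * (C * (M + 1) ^ r)) :
    4 * D / κ * Real.exp (-(κ ^ 2 * S / (4 * D))) ≤
      4 * C * (r + 2).factorial * (4 / c) ^ (r + 2) * σ ^ 2 / κ ^ (2 * r + 5) / (M + 1) ^ 2 := by
  have hM : (0 : ℝ) < M + 1 := by positivity
  set x := κ ^ 2 * (c * (M + 1)) / 4 with hx
  have hx0 : 0 < x := by positivity
  have h1 : x ≤ κ ^ 2 * S / (4 * D) := by
    have : κ ^ 2 * S / (4 * D) = κ ^ 2 * (S / D) / 4 := by field_simp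
    rw [this, hx]
    gcongr
  -- In the power `r + 2`, the `r` factors absorb the growth of `D` and the other two leave a
  -- summable `(M + 1)⁻²`. The power of `κ` is `1 + 2(r + 2) = 2r + 5`.
  have h2 : Real.exp (-(κ ^ 2 * S / (4 * D))) ≤ (r + 2).factorial / x ^ (r + 2) := by
    calc Real.exp (-(κ ^ 2 * S / (4 * D))) ≤ Real.exp (-x) := Real.exp_le_exp.2 (by linarith)
      _ ≤ _ := by
        rw [Real.exp_neg, inv_le_comm₀ (Real.exp_pos _) (by positivity), inv_div]
        exact Real.pow_div_factorial_le_exp x hx0.le _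
  calc 4 * D / κ * Real.exp (-(κ ^ 2 * S / (4 * D)))
      ≤ 4 * (σ ^ 2 * (C * (M + 1) ^ r)) / κ * ((r + 2).factorial / x ^ (r + 2)) := by gcongr
    _ = _ := by
      rw [hx, div_pow, mul_pow, mul_pow, div_pow, ← pow_mul, pow_add ((M : ℝ) + 1) r 2]
      field_simp
      ring

end Deviations

/-! ### Size of the weights `|γ_k|⁻²` and of the maximal cut-off. -/

section Weights

lemma character_eq (k : ℤ) (x : ℝ) :
    character k x = Complex.exp ((-(2 * Real.pi * k * x) : ℝ) * Complex.I) := by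
  rw [character]; congr 1; push_cast; ring

lemma norm_character (k : ℤ) (x : ℝ) : ‖character k x‖ = 1 := by
  rw [character_eq, Complex.norm_exp_ofReal_mul_I]

lemma measurable_character (k : ℤ) : Measurable (character k) := by
  unfold character; fun_prop

lemma character_neg (k : ℤ) (x : ℝ) : character (-k) x = starRingEnd ℂ (character k x) := by
  rw [character_eq, character_eq, ← Complex.exp_conj]
  congr 1
  rw [map_mul, Complex.conj_ofReal, Complex.conj_I]
  push_cast
  ring

variable {g : ℝ → ℝ}

lemma IsDensity.integrable (hg : IsDensity g) : Integrable g := by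
  refine ⟨hg.measurable.aestronglyMeasurable, ?_⟩
  rw [hasFiniteIntegral_iff_ofReal (ae_of_all _ hg.nonneg), hg.lintegral_eq_one]
  exact ENNReal.one_lt_top

lemma IsDensity.integral_eq_one (hg : IsDensity g) : ∫ x, g x = 1 := by
  rw [integral_eq_lintegral_of_nonneg_ae (ae_of_all _ hg.nonneg)
    hg.measurable.aestronglyMeasurable, hg.lintegral_eq_one, ENNReal.toReal_one]

lemma IsDensity.shiftCoeff_zero (hg : IsDensity g) : shiftCoeff g 0 = 1 := by
  simp only [shiftCoeff, character, Int.cast_zero, mul_zero, zero_mul, Complex.exp_zero, one_mul]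
  rw [integral_complex_ofReal, hg.integral_eq_one, Complex.ofReal_one]

lemma shiftCoeff_neg (k : ℤ) : shiftCoeff g (-k) = starRingEnd ℂ (shiftCoeff g k) := by
  rw [shiftCoeff, shiftCoeff, ← integral_conj]
  simp [character_neg]

lemma norm_shiftCoeff_natAbs (k : ℤ) : ‖shiftCoeff g (k.natAbs : ℤ)‖ = ‖shiftCoeff g k‖ := by
  rcases Int.natAbs_eq k with h | h
  · rw [← h]
  · conv_rhs => rw [h, shiftCoeff_neg, RCLike.norm_conj]

lemma PolynomialDecay.shiftCoeff_ne_zero {β Cmin Cmax : ℝ} (hg : IsDensity g) (hC : 0 < Cmin)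
    (h : PolynomialDecay g β Cmin Cmax) (k : ℤ) : shiftCoeff g k ≠ 0 := by
  rcases eq_or_ne k 0 with rfl | hk
  · rw [hg.shiftCoeff_zero]; exact one_ne_zero
  · have := (h k hk).1
    have hk' : (0 : ℝ) < |(k : ℝ)| := by positivity
    rw [← norm_pos_iff]
    exact lt_of_lt_of_le (by positivity) this

/-- By the Riemann–Lebesgue lemma the coefficients of a density cannot stay bounded below. -/
lemma PolynomialDecay.exponent_pos {β Cmin Cmax : ℝ} (hβ : 0 ≤ β)
    (hC : 0 < Cmin) (h : PolynomialDecay g β Cmin Cmax) : 0 < β := by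
  refine lt_of_le_of_ne hβ fun h0 => ?_
  subst h0
  have h1 := Real.tendsto_integral_exp_smul_cocompact (fun x => (g x : ℂ))
  have h2 : Filter.Tendsto (fun k : ℕ => ((k : ℕ) : ℝ)) Filter.atTop (Filter.cocompact ℝ) :=
    tendsto_natCast_atTop_atTop.mono_right atTop_le_cocompact
  have h3 := (h1.comp h2).norm
  rw [norm_zero] at h3
  have h4 : ∀ᶠ k : ℕ in Filter.atTop, Cmin ≤ ‖((fun w : ℝ => ∫ v : ℝ, Real.fourierChar
      (-(v * w)) • (g v : ℂ)) ∘ fun k : ℕ => (k : ℝ)) k‖ := by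
    filter_upwards [Filter.eventually_ge_atTop 1] with k hk
    have h5 := (h (k : ℤ) (by positivity)).1
    simp only [neg_zero, Real.rpow_zero, mul_one] at h5
    refine h5.trans (le_of_eq ?_)
    congr 1
    rw [shiftCoeff, Function.comp_apply]
    refine integral_congr_ae (ae_of_all _ fun x => ?_)
    dsimp only
    rw [Circle.smul_def, Real.fourierChar_apply, character_eq, smul_eq_mul]
    congr 3
    push_cast
    ring
  exact absurd (ge_of_tendsto h3 h4) (by linarith)

lemma PolynomialDecay.inv_normSq_bounds {β Cmin Cmax : ℝ} (hC : 0 < Cmin)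
    (h : PolynomialDecay g β Cmin Cmax) {k : ℤ} (hk : k ≠ 0) :
    (Cmax ^ 2)⁻¹ * |(k : ℝ)| ^ (2 * β) ≤ (‖shiftCoeff g k‖ ^ 2)⁻¹ ∧
      (‖shiftCoeff g k‖ ^ 2)⁻¹ ≤ (Cmin ^ 2)⁻¹ * |(k : ℝ)| ^ (2 * β) := by
  obtain ⟨h1, h2⟩ := h k hk
  have hk' : (0 : ℝ) < |(k : ℝ)| := by positivity
  have hp : 0 < Cmin * |(k : ℝ)| ^ (-β) := by positivity
  have hn : 0 < ‖shiftCoeff g k‖ := hp.trans_le h1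
  have e : ∀ C : ℝ, ((C * |(k : ℝ)| ^ (-β)) ^ 2)⁻¹ = (C ^ 2)⁻¹ * |(k : ℝ)| ^ (2 * β) := fun C => by
    rw [mul_pow, mul_inv, ← Real.rpow_natCast (_ ^ (-β)), ← Real.rpow_mul hk'.le,
      ← Real.rpow_neg hk'.le]
    congr 2
    push_cast; ring
  rw [← e, ← e]
  constructor
  · gcongr
  · gcongr

/-- The weights `|γ_k|⁻²` for `|k| ≤ M` are of the order of `M ^ (2 β)` in sum and in maximum. -/
lemma PolynomialDecay.exists_weight_bound {β Cmin Cmax : ℝ} (hg : IsDensity g) (hβ : 0 ≤ β)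
    (hC : 0 < Cmin) (hCmax : Cmin ≤ Cmax) (h : PolynomialDecay g β Cmin Cmax) :
    ∃ c > 0, ∃ C > 0, ∃ r : ℕ, ∀ M : ℕ, ∃ D > 0,
      (∀ k ∈ window M, (‖shiftCoeff g k‖ ^ 2)⁻¹ ≤ D) ∧
      c * (M + 1) ≤ (∑ k ∈ window M, (‖shiftCoeff g k‖ ^ 2)⁻¹) / D ∧
      D ≤ C * (M + 1) ^ r := by
  have hC' : 0 < Cmax := hC.trans_le hCmax
  have h2β : 0 ≤ 2 * β := by linarith
  set C₁ := max 1 (Cmin ^ 2)⁻¹ with hC₁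
  have hC₁1 : 1 ≤ C₁ := le_max_left _ _
  have hC₁0 : 0 < C₁ := by linarith
  set c₁ := min 1 ((Cmax ^ 2)⁻¹ * (1 / 4 : ℝ) ^ (2 * β)) with hc₁
  have hc₁0 : 0 < c₁ := by
    rw [hc₁]
    exact lt_min one_pos (by positivity)
  refine ⟨c₁ / (2 * C₁), by positivity, C₁, hC₁0, ⌈2 * β⌉₊, fun M => ?_⟩
  have hM0 : (0 : ℝ) < M + 1 := by positivity
  have hM1 : (1 : ℝ) ≤ M + 1 := by
    have : (0 : ℝ) ≤ M := by positivity
    linarith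
  have hP : 0 < ((M : ℝ) + 1) ^ (2 * β) := by positivity
  have hz : (‖shiftCoeff g 0‖ ^ 2)⁻¹ = 1 := by simp [hg.shiftCoeff_zero]
  refine ⟨C₁ * (M + 1) ^ (2 * β), by positivity, fun k hk => ?_, ?_, ?_⟩
  · rw [mem_window] at hk
    rcases eq_or_ne k 0 with rfl | hk0
    · rw [hz]
      have := Real.one_le_rpow hM1 h2β
      nlinarith
    · refine (h.inv_normSq_bounds hC hk0).2.trans ?_
      have h3 : |(k : ℝ)| ≤ M + 1 := by
        have : |(k : ℝ)| ≤ M := by exact_mod_cast hk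
        linarith
      have h4 : (Cmin ^ 2)⁻¹ ≤ C₁ := le_max_right _ _
      gcongr
  -- The frequencies from `(M + 1) / 2` to `M` suffice: there are at least `(M + 1) / 2` of them,
  -- each with weight of the order of the maximum. They satisfy `M + 1 ≤ 4j`, except `j = 0` when `M
  -- = 0`, where the weight is `1`.
  · have key : ∀ k ∈ (Finset.Icc ((M + 1) / 2) M).image (fun j : ℕ => (j : ℤ)),
        c₁ * (M + 1) ^ (2 * β) ≤ (‖shiftCoeff g k‖ ^ 2)⁻¹ := fun k hk => by
      obtain ⟨j, hj, rfl⟩ := Finset.mem_image.1 hk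
      rw [Finset.mem_Icc] at hj
      rcases Nat.eq_zero_or_pos j with rfl | hj0
      · have hM : M = 0 := by omega
        subst hM
        simp only [Nat.cast_zero, zero_add, Real.one_rpow, mul_one, hz]
        exact min_le_left _ _
      · refine le_trans ?_ (h.inv_normSq_bounds hC (by positivity : (j : ℤ) ≠ 0)).1
        have h5 : 1 / 4 * ((M : ℝ) + 1) ≤ |((j : ℤ) : ℝ)| := by
          rw [Int.cast_natCast, Nat.abs_cast]
          have : M + 1 ≤ 4 * j := by omega
          have : (M : ℝ) + 1 ≤ 4 * j := by exact_mod_cast this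
          linarith
        calc c₁ * ((M : ℝ) + 1) ^ (2 * β)
            ≤ (Cmax ^ 2)⁻¹ * (1 / 4 : ℝ) ^ (2 * β) * ((M : ℝ) + 1) ^ (2 * β) := by
              gcongr; exact min_le_right _ _
          _ = (Cmax ^ 2)⁻¹ * (1 / 4 * ((M : ℝ) + 1)) ^ (2 * β) := by
              rw [Real.mul_rpow (by norm_num) hM0.le]; ring
          _ ≤ _ := by gcongr
    have hsub : (Finset.Icc ((M + 1) / 2) M).image (fun j : ℕ => (j : ℤ)) ⊆ window M :=
      fun k hk => by
      obtain ⟨j, hj, rfl⟩ := Finset.mem_image.1 hk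
      rw [Finset.mem_Icc] at hj
      rw [mem_window, Nat.abs_cast]
      exact_mod_cast hj.2
    have hcard : ((M : ℝ) + 1) / 2 ≤
        ((Finset.Icc ((M + 1) / 2) M).image (fun j : ℕ => (j : ℤ))).card := by
      rw [Finset.card_image_of_injective _ Nat.cast_injective, Nat.card_Icc]
      have : M + 1 ≤ 2 * (M + 1 - (M + 1) / 2) := by omega
      have : (M : ℝ) + 1 ≤ 2 * ((M + 1 - (M + 1) / 2 : ℕ) : ℝ) := by exact_mod_cast this
      linarith
    rw [le_div_iff₀ (by positivity)]
    calc c₁ / (2 * C₁) * (M + 1) * (C₁ * (M + 1) ^ (2 * β))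
        = ((M : ℝ) + 1) / 2 * (c₁ * (M + 1) ^ (2 * β)) := by field_simp
      _ ≤ ((Finset.Icc ((M + 1) / 2) M).image (fun j : ℕ => (j : ℤ))).card *
          (c₁ * (M + 1) ^ (2 * β)) := by gcongr
      _ ≤ ∑ k ∈ (Finset.Icc ((M + 1) / 2) M).image (fun j : ℕ => (j : ℤ)),
          (‖shiftCoeff g k‖ ^ 2)⁻¹ := by
          rw [← nsmul_eq_mul]
          exact Finset.card_nsmul_le_sum _ _ _ key
      _ ≤ _ := Finset.sum_le_sum_of_subset_of_nonneg hsub fun _ _ _ => by positivity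
  · gcongr
    rw [← Real.rpow_natCast]
    exact Real.rpow_le_rpow_of_exponent_le hM1 (Nat.le_ceil _)

/-- This puts `|γ_0| = 1` above the threshold defining `m₀`. It holds because `log n = 2 log √n <
√n`. -/
lemma log_sq_div_lt_one {n : ℕ} (hn : 1 ≤ n) : Real.log n ^ 2 / n < 1 := by
  have h0 : (0 : ℝ) < n := by exact_mod_cast hn
  have hs : 0 < √(n : ℝ) := Real.sqrt_pos.2 h0
  have h1 : Real.log n = 2 * Real.log (√(n : ℝ)) := by
    rw [Real.log_sqrt h0.le]; ring
  have h2 := Real.log_le_sub_one_of_pos (x := √(n : ℝ) / 2) (by positivity)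
  rw [Real.log_div hs.ne' (by norm_num)] at h2
  have h3 := Real.log_two_lt_d9
  have h4 : Real.log n < √(n : ℝ) := by rw [h1]; linarith
  have h5 : 0 ≤ Real.log n := Real.log_natCast_nonneg n
  rw [div_lt_one h0]
  calc Real.log n ^ 2 < √(n : ℝ) ^ 2 := pow_lt_pow_left₀ h4 h5 (by norm_num)
    _ = n := Real.sq_sqrt h0.le

lemma log_sq_div_lt_of_mem_window (hg : IsDensity g) {n : ℕ} (hn : 1 ≤ n) {k : ℤ}
    (hk : k ∈ window (maxCutoff g n)) : Real.log n ^ 2 / n < ‖shiftCoeff g k‖ ^ 2 := by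
  rcases eq_or_ne k 0 with rfl | hk0
  · rw [hg.shiftCoeff_zero]
    simpa using log_sq_div_lt_one hn
  · rw [mem_window, maxCutoff, Int.abs_eq_natAbs] at hk
    have hk1 : k.natAbs ≠ 0 := Int.natAbs_ne_zero.2 hk0
    -- `m₀` is a truncated `sInf - 1`, so `k ≠ 0` and `|k| ≤ m₀` force `|k| < sInf`. If `sInf` is
    -- `0`, as by default for the empty set, the window is `{0}` and no such `k` exists.
    have h1 := Nat.notMem_of_lt_sInf (s := {k : ℕ | ‖shiftCoeff g k‖ ^ 2 ≤ Real.log n ^ 2 / n})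
      (m := k.natAbs) (by omega)
    rw [Set.mem_ofPred_eq, not_le, norm_shiftCoeff_natAbs] at h1
    exact h1

lemma quarter_le_log_sq {n : ℕ} (hn : 2 ≤ n) : 1 / 4 ≤ Real.log n ^ 2 := by
  have h1 : Real.log 2 ≤ Real.log n := Real.log_le_log (by norm_num) (by exact_mod_cast hn)
  nlinarith [Real.log_two_gt_d9]

lemma inv_normSq_le_of_mem_window (hg : IsDensity g) {n : ℕ} (hn : 2 ≤ n) {k : ℤ}
    (hk : k ∈ window (maxCutoff g n)) : (‖shiftCoeff g k‖ ^ 2)⁻¹ ≤ 4 * n := by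
  have h1 := log_sq_div_lt_of_mem_window hg (by omega) hk
  have h2 := quarter_le_log_sq hn
  have h0 : (0 : ℝ) < n := by exact_mod_cast (by omega : 0 < n)
  have h3 : (4 * (n : ℝ))⁻¹ ≤ ‖shiftCoeff g k‖ ^ 2 := by
    refine le_trans ?_ h1.le
    rw [inv_le_iff_one_le_mul₀ (by positivity)]
    field_simp
    linarith
  exact inv_le_of_inv_le₀ (by positivity) h3

/-- At `k = m₀` the weight is at most `4n` by the choice of `m₀`, and at least `m₀^(2β) / Cmax²` by
the decay. Since `β > 0`, `m₀` is polynomially bounded in `n`. -/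
lemma PolynomialDecay.exists_maxCutoff_le {β Cmin Cmax : ℝ} (hg : IsDensity g) (hβ : 0 < β)
    (hC : 0 < Cmin) (h : PolynomialDecay g β Cmin Cmax) :
    ∃ C > 0, ∃ q : ℕ, ∀ n : ℕ, 2 ≤ n → 2 * (maxCutoff g n : ℝ) + 1 ≤ C * n ^ q := by
  set B := max 1 (4 * Cmax ^ 2) with hB
  have hB1 : 1 ≤ B := le_max_left _ _
  refine ⟨3 * B ^ ⌈(2 * β)⁻¹⌉₊, by positivity, ⌈(2 * β)⁻¹⌉₊, fun n hn => ?_⟩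
  have hn1 : (1 : ℝ) ≤ n := by exact_mod_cast (by omega : 1 ≤ n)
  have hBn : 1 ≤ B * n := by nlinarith
  rw [mul_assoc, ← mul_pow]
  have h1 : 1 ≤ (B * n) ^ ⌈(2 * β)⁻¹⌉₊ := one_le_pow₀ hBn
  suffices hs : (maxCutoff g n : ℝ) ≤ (B * n) ^ ⌈(2 * β)⁻¹⌉₊ by linarith
  rcases Nat.eq_zero_or_pos (maxCutoff g n) with h0 | h0
  · rw [h0]; push_cast; linarith
  have hm0 : (0 : ℝ) < maxCutoff g n := by exact_mod_cast h0
  have h2 := (h.inv_normSq_bounds hC (k := (maxCutoff g n : ℤ)) (by positivity)).1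
  have h3 := inv_normSq_le_of_mem_window hg hn (k := (maxCutoff g n : ℤ))
    (by rw [mem_window, Nat.abs_cast])
  have h4 := h2.trans h3
  rw [Int.cast_natCast, Nat.abs_cast] at h4
  have hCm : 0 < Cmax := by
    have h5 := h 1 one_ne_zero
    have h6 := h5.1.trans h5.2
    simp only [Int.cast_one, abs_one, Real.one_rpow, mul_one] at h6
    linarith
  rw [inv_mul_le_iff₀ (by positivity)] at h4
  have h5 : (maxCutoff g n : ℝ) ^ (2 * β) ≤ B * n := by
    have : 4 * Cmax ^ 2 ≤ B := le_max_right _ _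
    nlinarith
  calc (maxCutoff g n : ℝ) = ((maxCutoff g n : ℝ) ^ (2 * β)) ^ (2 * β)⁻¹ := by
        rw [← Real.rpow_mul hm0.le, mul_inv_cancel₀ (by positivity), Real.rpow_one]
    _ ≤ (B * n) ^ (2 * β)⁻¹ := by gcongr
    _ ≤ (B * n) ^ (⌈(2 * β)⁻¹⌉₊ : ℝ) :=
        Real.rpow_le_rpow_of_exponent_le hBn (Nat.le_ceil _)
    _ = _ := Real.rpow_natCast _ _

/-- Bessel's inequality: the coefficients of a square integrable template are square summable. -/
lemma summable_normSq_templateCoeff {f : ℝ → ℝ}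
    (hf : MemLp f 2 (volume.restrict (Set.Icc (0 : ℝ) 1))) :
    Summable fun k => ‖templateCoeff f k‖ ^ 2 := by
  have h1 : MemLp (fun x => (f x : ℂ)) 2 (volume.restrict (Set.Ioc (0 : ℝ) 1)) :=
    (hf.mono_measure (Measure.restrict_mono Set.Ioc_subset_Icc_self le_rfl)).ofReal
  have h2 := (hasSum_sq_fourierCoeffOn zero_lt_one h1).summable
  refine h2.congr fun k => ?_
  congr 2
  rw [fourierCoeffOn_eq_integral, templateCoeff]
  simp only [sub_zero, div_one, one_smul, smul_eq_mul]
  refine intervalIntegral.integral_congr fun x _ => ?_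
  simp only [fourier_coe_apply, character]
  congr 2
  push_cast
  ring

end Weights

/-! ### Concentration of the empirical Fourier coefficients of the shifts. -/

section Shifts

/-- The empirical Fourier coefficient of the shifts. -/
def empiricalCoeff {n : ℕ} (k : ℤ) (t : Fin n → ℝ) : ℂ :=
  (1 / (n : ℂ)) * ∑ j, character k (t j)

lemma measurable_empiricalCoeff {n : ℕ} (k : ℤ) :
    Measurable (empiricalCoeff k : (Fin n → ℝ) → ℂ) := by
  have := measurable_character k
  unfold empiricalCoeff
  fun_prop

lemma norm_empiricalCoeff_le {n : ℕ} (k : ℤ) (t : Fin n → ℝ) : ‖empiricalCoeff k t‖ ≤ 1 := by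
  rw [empiricalCoeff, norm_mul]
  have h1 : ‖∑ j, character k (t j)‖ ≤ n := by
    refine (norm_sum_le _ _).trans ?_
    simp [norm_character]
  rcases Nat.eq_zero_or_pos n with rfl | hn
  · simp
  · have hn' : (0 : ℝ) < n := by exact_mod_cast hn
    rw [norm_div, norm_one, Complex.norm_natCast, one_div, inv_mul_le_iff₀ hn', mul_one]
    exact h1

variable {Ω : Type*} [MeasurableSpace Ω] {μ : Measure Ω} {g : ℝ → ℝ}
  {n : ℕ} {τ : Fin n → Ω → ℝ} {z : ℤ → Fin n → Ω → ℂ}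

lemma IsShiftModel.integral_comp_shift (h : IsShiftModel μ g τ z) (hg : IsDensity g) (j : Fin n)
    {φ : ℝ → ℝ} (hφ : Measurable φ) : ∫ ω, φ (τ j ω) ∂μ = ∫ x, φ x * g x := by
  rw [← integral_map (h.measurable_shift j).aemeasurable hφ.aestronglyMeasurable, h.law_shift,
    integral_withDensity_eq_integral_toReal_smul (by have := hg.measurable; fun_prop)
      (ae_of_all _ fun _ => ENNReal.ofReal_lt_top)]
  refine integral_congr_ae (ae_of_all _ fun x => ?_)
  simp only [ENNReal.toReal_ofReal (hg.nonneg x), smul_eq_mul]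
  ring

/-- Hoeffding's lemma: values in `[-1, 1]` give sub-Gaussian parameter `(2 / 2)² = 1`. -/
lemma IsShiftModel.measureReal_sum_shift_ge_le [IsProbabilityMeasure μ] (h : IsShiftModel μ g τ z) (hg : IsDensity g)
    (hn : 0 < n) {φ : ℝ → ℝ} (hφ : Measurable φ) (hφ1 : ∀ x, |φ x| ≤ 1) {x : ℝ} (hx : 0 ≤ x) :
    μ.real {ω | n * x ≤ ∑ j, (φ (τ j ω) - ∫ x, φ x * g x)} ≤ Real.exp (-(n * x ^ 2) / 2) := by
  have hind : iIndepFun (fun j ω => φ (τ j ω) - ∫ x, φ x * g x) μ :=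
    h.indep_shift.comp (fun _ y => φ y - ∫ x, φ x * g x) fun _ => by fun_prop
  have hsub : ∀ j ∈ Finset.univ, HasSubgaussianMGF (fun ω => φ (τ j ω) - ∫ x, φ x * g x)
      ((fun _ => 1 : Fin n → NNReal) j) μ := fun j _ => by
    have h1 := hasSubgaussianMGF_of_mem_Icc (μ := μ) (X := fun ω => φ (τ j ω)) (a := -1) (b := 1)
      (hφ.comp (h.measurable_shift j)).aemeasurable
      (ae_of_all _ fun ω => Set.mem_Icc.2 (abs_le.1 (hφ1 _)))
    rw [h.integral_comp_shift hg j hφ] at h1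
    convert h1 using 1
    have : ‖(1 : ℝ) - -1‖₊ = 2 := by
      rw [show (1 : ℝ) - -1 = 2 by norm_num]; simp
    rw [this]; norm_num
  have h2 := HasSubgaussianMGF.measure_sum_ge_le_of_iIndepFun hind hsub
    (ε := n * x) (by positivity)
  refine h2.trans (Real.exp_le_exp.2 (le_of_eq ?_))
  have hn' : (n : ℝ) ≠ 0 := by exact_mod_cast hn.ne'
  simp
  field_simp

lemma integral_re_character_mul (hg : IsDensity g) (k : ℤ) :
    ∫ x, (character k x).re * g x = (shiftCoeff g k).re := by
  have hi : Integrable fun x => character k x * (g x : ℂ) :=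
    hg.integrable.ofReal.bdd_mul (c := 1) (measurable_character k).aestronglyMeasurable
      (ae_of_all _ fun x => (norm_character k x).le)
  have := integral_re hi
  rw [shiftCoeff]
  simpa using this

lemma integral_im_character_mul (hg : IsDensity g) (k : ℤ) :
    ∫ x, (character k x).im * g x = (shiftCoeff g k).im := by
  have hi : Integrable fun x => character k x * (g x : ℂ) :=
    hg.integrable.ofReal.bdd_mul (c := 1) (measurable_character k).aestronglyMeasurable
      (ae_of_all _ fun x => (norm_character k x).le)
  have := integral_im hi
  rw [shiftCoeff]
  simpa using this

/-- Hoeffding's inequality for the empirical Fourier coefficient of the shifts. -/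
lemma IsShiftModel.measureReal_empiricalCoeff_le [IsProbabilityMeasure μ] (h : IsShiftModel μ g τ z) (hg : IsDensity g)
    (hn : 0 < n) (k : ℤ) {x : ℝ} (hx : 0 ≤ x) :
    μ.real {ω | x < ‖empiricalCoeff k (fun j => τ j ω) - shiftCoeff g k‖} ≤
      4 * Real.exp (-(n * x ^ 2) / 8) := by
  have hn' : (0 : ℝ) < n := by exact_mod_cast hn
  have hm := measurable_character k
  have hre : ∀ y, |(character k y).re| ≤ 1 := fun y =>
    (Complex.abs_re_le_norm _).trans (norm_character k y).le
  have him : ∀ y, |(character k y).im| ≤ 1 := fun y =>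
    (Complex.abs_im_le_norm _).trans (norm_character k y).le
  have hx2 : 0 ≤ x / 2 := by positivity
  have b1 := h.measureReal_sum_shift_ge_le hg hn (φ := fun y => (character k y).re)
    (by fun_prop) hre hx2
  have b2 := h.measureReal_sum_shift_ge_le hg hn (φ := fun y => -(character k y).re)
    (by fun_prop) (fun y => by rw [abs_neg]; exact hre y) hx2
  have b3 := h.measureReal_sum_shift_ge_le hg hn (φ := fun y => (character k y).im)
    (by fun_prop) him hx2
  have b4 := h.measureReal_sum_shift_ge_le hg hn (φ := fun y => -(character k y).im)
    (by fun_prop) (fun y => by rw [abs_neg]; exact him y) hx2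
  simp only [neg_mul, integral_neg, integral_re_character_mul hg,
    integral_im_character_mul hg] at b1 b2 b3 b4
  -- A modulus above `x` forces the real or the imaginary part, with one of its two signs, to reach
  -- `x / 2`.
  have hsub : {ω | x < ‖empiricalCoeff k (fun j => τ j ω) - shiftCoeff g k‖} ⊆
      ({ω | n * (x / 2) ≤ ∑ j, ((character k (τ j ω)).re - (shiftCoeff g k).re)} ∪
        {ω | n * (x / 2) ≤ ∑ j, (-(character k (τ j ω)).re - -(shiftCoeff g k).re)}) ∪
      ({ω | n * (x / 2) ≤ ∑ j, ((character k (τ j ω)).im - (shiftCoeff g k).im)} ∪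
        {ω | n * (x / 2) ≤ ∑ j, (-(character k (τ j ω)).im - -(shiftCoeff g k).im)}) := by
    intro ω hω
    have hω' : x < ‖empiricalCoeff k (fun j => τ j ω) - shiftCoeff g k‖ := hω
    set v := empiricalCoeff k (fun j => τ j ω) - shiftCoeff g k with hv
    have e0 : (n : ℂ) * v = ∑ j, (character k (τ j ω) - shiftCoeff g k) := by
      have : (n : ℂ) ≠ 0 := by exact_mod_cast hn.ne'
      rw [hv, empiricalCoeff, Finset.sum_sub_distrib]
      simp
      field_simp
    have e1 : (n : ℝ) * v.re = ∑ j, ((character k (τ j ω)).re - (shiftCoeff g k).re) := by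
      have := congrArg Complex.re e0
      simpa using this
    have e2 : (n : ℝ) * v.im = ∑ j, ((character k (τ j ω)).im - (shiftCoeff g k).im) := by
      have := congrArg Complex.im e0
      simpa using this
    have e3 : ∑ j, (-(character k (τ j ω)).re - -(shiftCoeff g k).re) = n * (-v.re) := by
      rw [mul_neg, e1, ← Finset.sum_neg_distrib]
      exact Finset.sum_congr rfl fun _ _ => by ring
    have e4 : ∑ j, (-(character k (τ j ω)).im - -(shiftCoeff g k).im) = n * (-v.im) := by
      rw [mul_neg, e2, ← Finset.sum_neg_distrib]
      exact Finset.sum_congr rfl fun _ _ => by ring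
    simp only [Set.mem_union, Set.mem_ofPred_eq, ← e1, ← e2, e3, e4, mul_le_mul_iff_right₀ hn']
    have := Complex.norm_le_abs_re_add_abs_im v
    by_contra hcon
    push Not at hcon
    have h1 : |v.re| < x / 2 := abs_lt.2 ⟨by linarith [hcon.1.2], hcon.1.1⟩
    have h2 : |v.im| < x / 2 := abs_lt.2 ⟨by linarith [hcon.2.2], hcon.2.1⟩
    linarith
  have he : -((n : ℝ) * (x / 2) ^ 2) / 2 = -(n * x ^ 2) / 8 := by ring
  rw [he] at b1 b2 b3 b4
  refine (measureReal_mono hsub).trans ?_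
  refine (measureReal_union_le _ _).trans ?_
  have u1 := measureReal_union_le (μ := μ)
    {ω | n * (x / 2) ≤ ∑ j, ((character k (τ j ω)).re - (shiftCoeff g k).re)}
    {ω | n * (x / 2) ≤ ∑ j, (-(character k (τ j ω)).re - -(shiftCoeff g k).re)}
  have u2 := measureReal_union_le (μ := μ)
    {ω | n * (x / 2) ≤ ∑ j, ((character k (τ j ω)).im - (shiftCoeff g k).im)}
    {ω | n * (x / 2) ≤ ∑ j, (-(character k (τ j ω)).im - -(shiftCoeff g k).im)}
  linarith

/-- The shifts for which all empirical coefficients `|k| ≤ m` are relatively close to the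
coefficients of the density. -/
def goodShifts (g : ℝ → ℝ) (n m : ℕ) (t : ℝ) : Set (Fin n → ℝ) :=
  {x | ∀ k ∈ window m, ‖empiricalCoeff k x - shiftCoeff g k‖ ≤ t * ‖shiftCoeff g k‖}

lemma measurableSet_goodShifts (n m : ℕ) (t : ℝ) : MeasurableSet (goodShifts g n m t) := by
  have : goodShifts g n m t = ⋂ k ∈ window m,
      {x | ‖empiricalCoeff k x - shiftCoeff g k‖ ≤ t * ‖shiftCoeff g k‖} := by
    ext x; simp [goodShifts]
  rw [this]
  refine Finset.measurableSet_biInter _ fun k _ => ?_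
  have := measurable_empiricalCoeff (n := n) k
  exact measurableSet_le (by fun_prop) (by fun_prop)

lemma card_window (m : ℕ) : ((window m).card : ℝ) = 2 * m + 1 := by
  rw [window, Int.card_Icc]
  have : ((m : ℤ) + 1 - -(m : ℤ)).toNat = 2 * m + 1 := by omega
  rw [this]; push_cast; ring

/-- The definition of `m₀` enters here: for `|k| ≤ m₀` the Hoeffding exponent at level `t|γ_k|` is
at least `t² log² n / 8`, whatever `k`. A union bound over the window follows. -/
lemma IsShiftModel.measureReal_not_goodShifts_le [IsProbabilityMeasure μ] (h : IsShiftModel μ g τ z) (hg : IsDensity g)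
    (hn : 0 < n) {t : ℝ} (ht : 0 ≤ t) :
    μ.real {ω | (fun j => τ j ω) ∉ goodShifts g n (maxCutoff g n) t} ≤
      (2 * (maxCutoff g n : ℝ) + 1) * (4 * Real.exp (-(t ^ 2 * Real.log n ^ 2) / 8)) := by
  have hn' : (0 : ℝ) < n := by exact_mod_cast hn
  have hsub : {ω | (fun j => τ j ω) ∉ goodShifts g n (maxCutoff g n) t} ⊆
      ⋃ k ∈ window (maxCutoff g n),
        {ω | t * ‖shiftCoeff g k‖ < ‖empiricalCoeff k (fun j => τ j ω) - shiftCoeff g k‖} := by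
    intro ω hω
    simp only [goodShifts, Set.mem_ofPred_eq] at hω
    push Not at hω
    obtain ⟨k, hk, hk'⟩ := hω
    exact Set.mem_biUnion hk hk'
  refine (measureReal_mono hsub (measure_ne_top _ _)).trans ((measureReal_biUnion_finset_le _ _).trans ?_)
  rw [← card_window, ← nsmul_eq_mul]
  refine Finset.sum_le_card_nsmul _ _ _ fun k hk => ?_
  refine (h.measureReal_empiricalCoeff_le hg hn k (by positivity)).trans ?_
  have h1 := (log_sq_div_lt_of_mem_window hg hn hk).le
  rw [div_le_iff₀ hn'] at h1
  have h2 : t ^ 2 * Real.log n ^ 2 ≤ t ^ 2 * (‖shiftCoeff g k‖ ^ 2 * n) := by gcongr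
  refine mul_le_mul_of_nonneg_left (Real.exp_le_exp.2 ?_) (by norm_num)
  linarith

end Shifts

/-! ### Signal-plus-noise form of the observations, the criterion and the loss. -/

section Decomposition

/-- The part of the deconvolved mean coefficient that comes from the template. -/
def signalCoeff (g f : ℝ → ℝ) {n : ℕ} (x : Fin n → ℝ) (k : ℤ) : ℂ :=
  templateCoeff f k * (empiricalCoeff k x / shiftCoeff g k)

/-- The weight of the normalized noise in the deconvolved mean coefficient. -/
def noiseWeight (g : ℝ → ℝ) (ε : ℝ) (n : ℕ) (k : ℤ) : ℂ :=
  ((ε / √(n : ℝ) : ℝ) : ℂ) / shiftCoeff g k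

variable {g f : ℝ → ℝ} {ε : ℝ} {n : ℕ}

lemma measurable_signalCoeff (k : ℤ) :
    Measurable fun x : Fin n → ℝ => signalCoeff g f x k := by
  have := measurable_empiricalCoeff (n := n) k
  unfold signalCoeff
  fun_prop

lemma norm_noiseWeight_sq (g : ℝ → ℝ) (ε : ℝ) (n : ℕ) (k : ℤ) :
    ‖noiseWeight g ε n k‖ ^ 2 = ε ^ 2 / n * (‖shiftCoeff g k‖ ^ 2)⁻¹ := by
  rw [noiseWeight, norm_div, Complex.norm_real, div_pow, Real.norm_eq_abs, sq_abs, div_pow,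
    Real.sq_sqrt (Nat.cast_nonneg _), div_eq_mul_inv (ε ^ 2 / (n : ℝ))]

lemma meanCoeff_div {Ω : Type*} (τ : Fin n → Ω → ℝ) (z : ℤ → Fin n → Ω → ℂ) (hn : 0 < n)
    (k : ℤ) (ω : Ω) : meanCoeff f ε τ z k ω / shiftCoeff g k =
      signalCoeff g f (fun j => τ j ω) k + noiseWeight g ε n k * normalizedNoise z k ω := by
  have h1 : ((√(n : ℝ) : ℝ) : ℂ) * ((√(n : ℝ) : ℝ) : ℂ) = n := by
    rw [← Complex.ofReal_mul, Real.mul_self_sqrt (Nat.cast_nonneg _), Complex.ofReal_natCast]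
  have h2 : meanCoeff f ε τ z k ω = templateCoeff f k * empiricalCoeff k (fun j => τ j ω) +
      ((ε / √(n : ℝ) : ℝ) : ℂ) * normalizedNoise z k ω := by
    simp only [meanCoeff, observedCoeff, empiricalCoeff, normalizedNoise,
      Finset.sum_add_distrib, ← Finset.mul_sum]
    rw [← h1]
    have : ((√(n : ℝ) : ℝ) : ℂ) ≠ 0 := by
      rw [Complex.ofReal_ne_zero, Real.sqrt_ne_zero (Nat.cast_nonneg _)]
      exact_mod_cast hn.ne'
    push_cast
    field_simp
  rw [h2, signalCoeff, noiseWeight]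
  ring

lemma criterion_eq (c : ℤ → ℂ) (N : ℕ) :
    criterion g ε n c N =
      ∑ k ∈ window N, (2 * ‖noiseWeight g ε n k‖ ^ 2 - ‖c k / shiftCoeff g k‖ ^ 2) := by
  rw [criterion, Finset.mul_sum, ← Finset.sum_neg_distrib, ← Finset.sum_add_distrib]
  refine Finset.sum_congr rfl fun k _ => ?_
  rw [norm_noiseWeight_sq, norm_div, div_pow]
  ring

/-- Outside the window the error is `θ_k` itself. Subtracting `‖θ_k‖²` inside makes the dependence
on `N` a finite sum, the form used in `loss_le_of_criterion_le`. -/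
lemma sqLoss_eq {θ : ℤ → ℂ} (hθ : Summable fun k => ‖θ k‖ ^ 2) (c : ℤ → ℂ) (N : ℕ) :
    sqLoss (filterEstimator g (cutoffFilter N) c) θ =
      ENNReal.ofReal (∑ k ∈ window N, (‖c k / shiftCoeff g k - θ k‖ ^ 2 - ‖θ k‖ ^ 2) +
        normSq θ) := by
  set d : ℤ → ℝ := fun k => if k ∈ window N then
    ‖c k / shiftCoeff g k - θ k‖ ^ 2 - ‖θ k‖ ^ 2 else 0 with hd
  have hds : HasSum d (∑ k ∈ window N, (‖c k / shiftCoeff g k - θ k‖ ^ 2 - ‖θ k‖ ^ 2)) := by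
    have : HasSum d (∑ k ∈ window N, d k) :=
      hasSum_sum_of_ne_finset_zero fun k hk => by simp [hd, hk]
    rwa [Finset.sum_congr rfl fun k hk => (if_pos hk : d k = _)] at this
  have hs := hds.add hθ.hasSum
  have he : ∀ k, ‖filterEstimator g (cutoffFilter N) c k - θ k‖ ^ 2 = d k + ‖θ k‖ ^ 2 :=
    fun k => by
    by_cases hk : k ∈ window N
    · have hk' := mem_window.1 hk
      simp [hd, hk, filterEstimator, cutoffFilter, hk']
    · have hk' : ¬|k| ≤ (N : ℤ) := fun h => hk (mem_window.2 h)
      simp [hd, hk, filterEstimator, cutoffFilter, hk']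
  rw [sqLoss, normSq, ← hs.tsum_eq, ENNReal.ofReal_tsum_of_nonneg (fun k => by
    rw [← he]; positivity) hs.summable]
  refine tsum_congr fun k => ?_
  rw [← he, ← ofReal_norm, ENNReal.ofReal_pow (norm_nonneg _)]

lemma sum_window_le_normSq {θ : ℤ → ℂ} (hθ : Summable fun k => ‖θ k‖ ^ 2) (N : ℕ) :
    ∑ k ∈ window N, ‖θ k‖ ^ 2 ≤ normSq θ :=
  hθ.sum_le_tsum _ fun _ _ => by positivity

end Decomposition

/-! ### One random variable controlling the noise at all cut-offs, and its expectation. -/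

section Overshoot

/-- The total overshoot of the deviations of the noise over their compensators, for the cut-offs
`L ≤ m` compared with the reference cut-off `M`. -/
def noiseOvershoot (θ u w x : ℤ → ℂ) (κ : ℝ) (m M : ℕ) : ℝ :=
  ∑ L ∈ Finset.range (m + 1),
    (max (|∑ k ∈ gap M L, inner ℝ (u k) (w k * x k)| -
        (κ * ∑ k ∈ gap M L, ‖u k‖ ^ 2 + κ * ∑ k ∈ window (max M L), ‖w k‖ ^ 2)) 0 +
      max (|∑ k ∈ gap M L, inner ℝ (u k - θ k) (w k * x k)| -
        (κ * ∑ k ∈ gap M L, ‖u k - θ k‖ ^ 2 + κ * ∑ k ∈ window (max M L), ‖w k‖ ^ 2)) 0 +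
      max (|∑ k ∈ window L, (‖w k * x k‖ ^ 2 - ‖w k‖ ^ 2)| -
        κ * ∑ k ∈ window L, ‖w k‖ ^ 2) 0)

lemma noiseOvershoot_nonneg (θ u w x : ℤ → ℂ) (κ : ℝ) (m M : ℕ) :
    0 ≤ noiseOvershoot θ u w x κ m M :=
  Finset.sum_nonneg fun _ _ => by positivity

/-- All summands are nonnegative, so the total dominates each of them. The bounds hold at every `L ≤
m` simultaneously and may be used at a random cut-off. -/
lemma le_noiseOvershoot (θ u w x : ℤ → ℂ) (κ : ℝ) {m M L : ℕ} (hL : L ≤ m) :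
    |∑ k ∈ gap M L, inner ℝ (u k) (w k * x k)| ≤
      κ * ∑ k ∈ gap M L, ‖u k‖ ^ 2 + κ * ∑ k ∈ window (max M L), ‖w k‖ ^ 2 +
        noiseOvershoot θ u w x κ m M ∧
    |∑ k ∈ gap M L, inner ℝ (u k - θ k) (w k * x k)| ≤
      κ * ∑ k ∈ gap M L, ‖u k - θ k‖ ^ 2 + κ * ∑ k ∈ window (max M L), ‖w k‖ ^ 2 +
        noiseOvershoot θ u w x κ m M ∧
    |∑ k ∈ window L, (‖w k * x k‖ ^ 2 - ‖w k‖ ^ 2)| ≤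
      κ * ∑ k ∈ window L, ‖w k‖ ^ 2 + noiseOvershoot θ u w x κ m M := by
  have h := Finset.single_le_sum (f := fun L =>
    (max (|∑ k ∈ gap M L, inner ℝ (u k) (w k * x k)| -
        (κ * ∑ k ∈ gap M L, ‖u k‖ ^ 2 + κ * ∑ k ∈ window (max M L), ‖w k‖ ^ 2)) 0 +
      max (|∑ k ∈ gap M L, inner ℝ (u k - θ k) (w k * x k)| -
        (κ * ∑ k ∈ gap M L, ‖u k - θ k‖ ^ 2 + κ * ∑ k ∈ window (max M L), ‖w k‖ ^ 2)) 0 +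
      max (|∑ k ∈ window L, (‖w k * x k‖ ^ 2 - ‖w k‖ ^ 2)| -
        κ * ∑ k ∈ window L, ‖w k‖ ^ 2) 0)) (fun _ _ => by positivity)
    (Finset.mem_range.2 (Nat.lt_succ_of_le hL))
  rw [← noiseOvershoot] at h
  have a1 := le_max_left (|∑ k ∈ gap M L, inner ℝ (u k) (w k * x k)| -
        (κ * ∑ k ∈ gap M L, ‖u k‖ ^ 2 + κ * ∑ k ∈ window (max M L), ‖w k‖ ^ 2)) 0
  have a2 := le_max_left (|∑ k ∈ gap M L, inner ℝ (u k - θ k) (w k * x k)| -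
        (κ * ∑ k ∈ gap M L, ‖u k - θ k‖ ^ 2 + κ * ∑ k ∈ window (max M L), ‖w k‖ ^ 2)) 0
  have a3 := le_max_left (|∑ k ∈ window L, (‖w k * x k‖ ^ 2 - ‖w k‖ ^ 2)| -
        κ * ∑ k ∈ window L, ‖w k‖ ^ 2) 0
  have b1 := le_max_right (|∑ k ∈ gap M L, inner ℝ (u k) (w k * x k)| -
        (κ * ∑ k ∈ gap M L, ‖u k‖ ^ 2 + κ * ∑ k ∈ window (max M L), ‖w k‖ ^ 2)) 0
  have b2 := le_max_right (|∑ k ∈ gap M L, inner ℝ (u k - θ k) (w k * x k)| -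
        (κ * ∑ k ∈ gap M L, ‖u k - θ k‖ ^ 2 + κ * ∑ k ∈ window (max M L), ‖w k‖ ^ 2)) 0
  have b3 := le_max_right (|∑ k ∈ window L, (‖w k * x k‖ ^ 2 - ‖w k‖ ^ 2)| -
        κ * ∑ k ∈ window L, ‖w k‖ ^ 2) 0
  refine ⟨?_, ?_, ?_⟩ <;> linarith

lemma sum_range_inv_sq_le (m : ℕ) :
    ∑ L ∈ Finset.range (m + 1), 1 / ((L : ℝ) + 1) ^ 2 ≤ 2 - 1 / ((m : ℝ) + 1) := by
  induction m with
  | zero => norm_num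
  | succ m ih =>
    rw [Finset.sum_range_succ]
    have h1 : (0 : ℝ) < m + 1 := by positivity
    have h2 : 1 / ((m : ℝ) + 1 + 1) ^ 2 ≤ 1 / ((m : ℝ) + 1) - 1 / ((m : ℝ) + 1 + 1) := by
      rw [div_sub_div _ _ h1.ne' (by positivity), div_le_div_iff₀ (by positivity) (by positivity)]
      nlinarith
    push_cast
    linarith

variable {Ω : Type*} [MeasurableSpace Ω] {μ : Measure Ω} {g f : ℝ → ℝ} {ε : ℝ} {n : ℕ}
  {τ : Fin n → Ω → ℝ} {z : ℤ → Fin n → Ω → ℂ}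

/-- Freezing the shifts turns `u` into constants. The bound for constant coefficients does not
involve them, so integrating over the shifts costs nothing. -/
lemma IsShiftModel.lintegral_linear_overshoot_shift_le [IsProbabilityMeasure μ]
    (h : IsShiftModel μ g τ z) (hn : 0 < n)
    {w : ℤ → ℂ} {D κ S : ℝ} (hD : 0 < D) (hκ : 0 < κ) {I : Finset ℤ}
    (hw : ∀ k ∈ I, ‖w k‖ ^ 2 ≤ D) {u : (Fin n → ℝ) → ℤ → ℂ}
    (hu : ∀ k, Measurable fun x => u x k) :
    ∫⁻ ω, ENNReal.ofReal (|∑ k ∈ I, inner ℝ (u (fun j => τ j ω) k)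
        (w k * normalizedNoise z k ω)| -
        (κ * ∑ k ∈ I, ‖u (fun j => τ j ω) k‖ ^ 2 + κ * S)) ∂μ ≤
      ENNReal.ofReal (2 * D / κ * Real.exp (-(κ ^ 2 * S / D))) := by
  have hu' : ∀ k, Measurable fun p : (Fin n → ℝ) × (ℤ → ℂ) => u p.1 k :=
    fun k => (hu k).comp measurable_fst
  rw [h.lintegral_shift_noise (F := fun x y => ENNReal.ofReal
    (|∑ k ∈ I, inner ℝ (u x k) (w k * y k)| - (κ * ∑ k ∈ I, ‖u x k‖ ^ 2 + κ * S)))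
    (by unfold Function.uncurry; fun_prop)]
  refine (lintegral_mono fun ω => h.lintegral_linear_overshoot_le hn hD hκ hw _).trans ?_
  simp

/-- Each of the three overshoots at `L` has mean at most `B / (L + 1)²`; the factor `6` is three
families times the bound `2` for the series. -/
lemma IsShiftModel.lintegral_noiseOvershoot_le [IsProbabilityMeasure μ]
    (h : IsShiftModel μ g τ z) (hn : 0 < n) (hε : 0 < ε) {κ c C : ℝ} {r : ℕ} (hκ : 0 < κ)
    (hκ' : κ ≤ 1) (hc : 0 < c) (hC : 0 < C)
    (hw : ∀ M : ℕ, ∃ D > 0, (∀ k ∈ window M, (‖shiftCoeff g k‖ ^ 2)⁻¹ ≤ D) ∧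
      c * (M + 1) ≤ (∑ k ∈ window M, (‖shiftCoeff g k‖ ^ 2)⁻¹) / D ∧ D ≤ C * (M + 1) ^ r)
    (m M : ℕ) :
    ∫⁻ ω, ENNReal.ofReal (noiseOvershoot (templateCoeff f) (signalCoeff g f fun j => τ j ω)
      (noiseWeight g ε n) (fun k => normalizedNoise z k ω) κ m M) ∂μ ≤
      ENNReal.ofReal (6 * (4 * C * (r + 2).factorial * (4 / c) ^ (r + 2) *
        (ε ^ 2 / n) / κ ^ (2 * r + 5))) := by
  have hn' : (0 : ℝ) < n := by exact_mod_cast hn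
  set B := 4 * C * (r + 2).factorial * (4 / c) ^ (r + 2) * (ε ^ 2 / n) / κ ^ (2 * r + 5) with hB
  have hB0 : 0 ≤ B := by positivity
  have hs2 : (ε / √(n : ℝ)) ^ 2 = ε ^ 2 / n := by rw [div_pow, Real.sq_sqrt hn'.le]
  have hbound : ∀ Q : ℕ, ∃ D > 0, (∀ k ∈ window Q, ‖noiseWeight g ε n k‖ ^ 2 ≤ D) ∧
      4 * D / κ * Real.exp (-(κ ^ 2 * (∑ k ∈ window Q, ‖noiseWeight g ε n k‖ ^ 2) / (4 * D))) ≤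
        B / (Q + 1) ^ 2 := fun Q => by
    obtain ⟨D, hD, h1, h2, h3⟩ := hw Q
    have hσ : 0 < ε ^ 2 / n := by positivity
    refine ⟨ε ^ 2 / n * D, by positivity, fun k hk => ?_, ?_⟩
    · rw [norm_noiseWeight_sq]
      gcongr
      exact h1 k hk
    · rw [hB, ← hs2]
      refine mul_exp_neg_le_of_poly hc hC hκ (by positivity) ?_ (by gcongr)
      simp_rw [norm_noiseWeight_sq]
      rwa [← Finset.mul_sum, hs2, mul_div_mul_left _ _ hσ.ne']
  have hm1 : ∀ k, Measurable fun ω => signalCoeff g f (fun j => τ j ω) k := fun k =>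
    (measurable_signalCoeff k).comp (measurable_pi_lambda _ h.measurable_shift)
  have hm2 := h.measurable_normalizedNoise
  -- The linear compensators use the window of `max M L`, so their decay in `max M L + 1` gives
  -- decay in `L + 1` for every `M`.
  have hmono : ∀ {L Q : ℕ}, L ≤ Q → B / ((Q : ℝ) + 1) ^ 2 ≤ B * (1 / ((L : ℝ) + 1) ^ 2) :=
    fun {L Q} hLQ => by
    have : (L : ℝ) ≤ Q := by exact_mod_cast hLQ
    rw [mul_one_div]
    gcongr
  have hexp : ∀ {D S : ℝ}, 0 < D → 0 ≤ S → 2 * D / κ * Real.exp (-(κ ^ 2 * S / D)) ≤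
      4 * D / κ * Real.exp (-(κ ^ 2 * S / (4 * D))) := fun hD hS => by
    gcongr
    · norm_num
    · linarith
  have hS : ∀ Q, 0 ≤ ∑ k ∈ window Q, ‖noiseWeight g ε n k‖ ^ 2 := fun Q =>
    Finset.sum_nonneg fun _ _ => by positivity
  have hlin : ∀ (u : (Fin n → ℝ) → ℤ → ℂ), (∀ k, Measurable fun x => u x k) → ∀ L : ℕ,
      ∫⁻ ω, ENNReal.ofReal (max (|∑ k ∈ gap M L, inner ℝ (u (fun j => τ j ω) k)
        (noiseWeight g ε n k * normalizedNoise z k ω)| -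
        (κ * ∑ k ∈ gap M L, ‖u (fun j => τ j ω) k‖ ^ 2 +
          κ * ∑ k ∈ window (max M L), ‖noiseWeight g ε n k‖ ^ 2)) 0) ∂μ ≤
      ENNReal.ofReal (B * (1 / ((L : ℝ) + 1) ^ 2)) := fun u hu L => by
    obtain ⟨D, hD, h1, h2⟩ := hbound (max M L)
    simp_rw [ENNReal.ofReal_max, ENNReal.ofReal_zero, max_eq_left zero_le]
    refine (h.lintegral_linear_overshoot_shift_le hn hD hκ
      (fun k hk => h1 k (gap_subset _ _ hk)) hu).trans (ENNReal.ofReal_le_ofReal ?_)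
    exact (hexp hD (hS _)).trans (h2.trans (hmono (le_max_right _ _)))
  have hquad : ∀ L : ℕ,
      ∫⁻ ω, ENNReal.ofReal (max (|∑ k ∈ window L,
        (‖noiseWeight g ε n k * normalizedNoise z k ω‖ ^ 2 - ‖noiseWeight g ε n k‖ ^ 2)| -
        κ * ∑ k ∈ window L, ‖noiseWeight g ε n k‖ ^ 2) 0) ∂μ ≤
      ENNReal.ofReal (B * (1 / ((L : ℝ) + 1) ^ 2)) := fun L => by
    obtain ⟨D, hD, h1, h2⟩ := hbound L
    simp_rw [ENNReal.ofReal_max, ENNReal.ofReal_zero, max_eq_left zero_le]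
    exact (h.lintegral_quadratic_overshoot_le hn hD hκ hκ' h1).trans
      (ENNReal.ofReal_le_ofReal (h2.trans (hmono le_rfl)))
  have hms := fun k => measurable_signalCoeff (g := g) (f := f) (n := n) k
  unfold noiseOvershoot
  simp_rw [ENNReal.ofReal_sum_of_nonneg fun (i : ℕ) _ => add_nonneg (add_nonneg (le_max_right _ _)
    (le_max_right _ _)) (le_max_right _ _), ENNReal.ofReal_add (add_nonneg (le_max_right _ (0 : ℝ))
    (le_max_right _ (0 : ℝ))) (le_max_right _ (0 : ℝ)),
    ENNReal.ofReal_add (le_max_right _ (0 : ℝ)) (le_max_right _ (0 : ℝ))]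
  rw [lintegral_finsetSum _ fun L _ => by fun_prop]
  calc _ ≤ ∑ L ∈ Finset.range (m + 1), ENNReal.ofReal (3 * B * (1 / ((L : ℝ) + 1) ^ 2)) := by
        refine Finset.sum_le_sum fun L _ => ?_
        rw [lintegral_add_left (by fun_prop), lintegral_add_left (by fun_prop)]
        refine (add_le_add (add_le_add (hlin _ hms L)
          (hlin (fun x k => signalCoeff g f x k - templateCoeff f k)
            (fun k => (hms k).sub_const _) L)) (hquad L)).trans (le_of_eq ?_)
        rw [← ENNReal.ofReal_add (by positivity) (by positivity),
          ← ENNReal.ofReal_add (by positivity) (by positivity)]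
        congr 1; ring
    _ = ENNReal.ofReal (3 * B * ∑ L ∈ Finset.range (m + 1), 1 / ((L : ℝ) + 1) ^ 2) := by
        rw [← ENNReal.ofReal_sum_of_nonneg fun _ _ => by positivity, Finset.mul_sum]
    _ ≤ _ := by
        refine ENNReal.ofReal_le_ofReal ?_
        have h1 := sum_range_inv_sq_le m
        have h2 : (0 : ℝ) ≤ 1 / ((m : ℝ) + 1) := by positivity
        nlinarith

end Overshoot

/-! ### Bounds of the risk, and the oracle inequality with free parameters. -/

section Risk

variable {Ω : Type*} {g f : ℝ → ℝ} {ε : ℝ} {n : ℕ}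
  {τ : Fin n → Ω → ℝ} {z : ℤ → Fin n → Ω → ℂ}

lemma sqLoss_meanCoeff_eq (hf : Summable fun k => ‖templateCoeff f k‖ ^ 2) (hn : 0 < n) (N : ℕ)
    (ω : Ω) :
    sqLoss (filterEstimator g (cutoffFilter N) (fun k => meanCoeff f ε τ z k ω))
      (templateCoeff f) =
      ENNReal.ofReal (∑ k ∈ window N, (‖signalCoeff g f (fun j => τ j ω) k +
        noiseWeight g ε n k * normalizedNoise z k ω - templateCoeff f k‖ ^ 2 -
          ‖templateCoeff f k‖ ^ 2) + normSq (templateCoeff f)) := by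
  rw [sqLoss_eq hf]
  simp_rw [meanCoeff_div τ z hn]

/-- A crude bound of the loss, uniform in the cut-off. -/
lemma sqLoss_le_crude (hg : IsDensity g) (hne : ∀ k, shiftCoeff g k ≠ 0)
    (hf : Summable fun k => ‖templateCoeff f k‖ ^ 2) (hn : 2 ≤ n) {N : ℕ}
    (hN : N ≤ maxCutoff g n) (ω : Ω) :
    sqLoss (filterEstimator g (cutoffFilter N) (fun k => meanCoeff f ε τ z k ω))
      (templateCoeff f) ≤
      ENNReal.ofReal ((1 + 32 * n) * normSq (templateCoeff f) +
        ∑ k ∈ window (maxCutoff g n),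
          2 * ‖noiseWeight g ε n k‖ ^ 2 * ‖normalizedNoise z k ω‖ ^ 2) := by
  rw [sqLoss_meanCoeff_eq hf (by omega)]
  refine ENNReal.ofReal_le_ofReal ?_
  have hterm : ∀ k ∈ window (maxCutoff g n), ‖signalCoeff g f (fun j => τ j ω) k +
      noiseWeight g ε n k * normalizedNoise z k ω - templateCoeff f k‖ ^ 2 ≤
      32 * n * ‖templateCoeff f k‖ ^ 2 +
        2 * ‖noiseWeight g ε n k‖ ^ 2 * ‖normalizedNoise z k ω‖ ^ 2 := fun k hk => by
    -- The empirical and true coefficients have modulus at most `1`, and the weight is at most `4n`: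
    -- `2² · 4n = 16n`.
    have h1 : ‖signalCoeff g f (fun j => τ j ω) k - templateCoeff f k‖ ^ 2 ≤
        16 * n * ‖templateCoeff f k‖ ^ 2 := by
      have e : signalCoeff g f (fun j => τ j ω) k - templateCoeff f k = templateCoeff f k *
          ((empiricalCoeff k (fun j => τ j ω) - shiftCoeff g k) / shiftCoeff g k) := by
        have := hne k
        rw [signalCoeff]
        field_simp
      have h2 : ‖empiricalCoeff k (fun j => τ j ω) - shiftCoeff g k‖ ≤ 2 := by
        refine (norm_sub_le _ _).trans ?_
        have h3 := norm_empiricalCoeff_le k (fun j => τ j ω)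
        have h4 : ‖shiftCoeff g k‖ ≤ 1 := by
          refine (norm_integral_le_integral_norm _).trans (le_of_eq ?_)
          rw [← hg.integral_eq_one]
          refine integral_congr_ae (ae_of_all _ fun x => ?_)
          simp [norm_character, abs_of_nonneg (hg.nonneg x)]
        linarith
      have h5 := inv_normSq_le_of_mem_window hg hn hk
      rw [e, norm_mul, mul_pow, norm_div, div_pow, div_eq_mul_inv]
      calc ‖templateCoeff f k‖ ^ 2 * (‖empiricalCoeff k (fun j => τ j ω) - shiftCoeff g k‖ ^ 2 *
            (‖shiftCoeff g k‖ ^ 2)⁻¹)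
          ≤ ‖templateCoeff f k‖ ^ 2 * (2 ^ 2 * (4 * n)) := by gcongr
        _ = _ := by ring
    have h6 := parallelogram_law_with_norm ℝ
      (signalCoeff g f (fun j => τ j ω) k - templateCoeff f k)
      (noiseWeight g ε n k * normalizedNoise z k ω)
    rw [norm_mul] at h6
    rw [add_sub_right_comm]
    nlinarith [norm_nonneg (signalCoeff g f (fun j => τ j ω) k - templateCoeff f k -
      noiseWeight g ε n k * normalizedNoise z k ω)]
  have h7 : ∑ k ∈ window N, (‖signalCoeff g f (fun j => τ j ω) k +
      noiseWeight g ε n k * normalizedNoise z k ω - templateCoeff f k‖ ^ 2 -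
        ‖templateCoeff f k‖ ^ 2) ≤
      ∑ k ∈ window (maxCutoff g n), ‖signalCoeff g f (fun j => τ j ω) k +
      noiseWeight g ε n k * normalizedNoise z k ω - templateCoeff f k‖ ^ 2 :=
    (Finset.sum_le_sum fun k _ => sub_le_self _ (by positivity)).trans
      (Finset.sum_le_sum_of_subset_of_nonneg (window_mono hN) fun _ _ _ => by positivity)
  have h8 := h7.trans (Finset.sum_le_sum hterm)
  rw [Finset.sum_add_distrib, ← Finset.mul_sum] at h8
  have h9 := mul_le_mul_of_nonneg_left (sum_window_le_normSq hf (maxCutoff g n))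
    (by positivity : (0 : ℝ) ≤ 32 * n)
  linarith

variable [MeasurableSpace Ω] {μ : Measure Ω}

/-- The risk at a fixed cut-off dominates its bias and its noise variance. -/
lemma IsShiftModel.le_cutoffRisk [IsProbabilityMeasure μ] (h : IsShiftModel μ g τ z)
    (hf : Summable fun k => ‖templateCoeff f k‖ ^ 2) (hn : 0 < n) {M m : ℕ} (hM : M ≤ m) :
    ENNReal.ofReal (∑ k ∈ gap M m, ‖templateCoeff f k‖ ^ 2 +
      ∑ k ∈ window M, ‖noiseWeight g ε n k‖ ^ 2) ≤ cutoffRisk μ g f ε τ z fun _ => M := by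
  have hms := fun k => measurable_signalCoeff (g := g) (f := f) (n := n) k
  have hms' : ∀ k, Measurable fun p : (Fin n → ℝ) × (ℤ → ℂ) => signalCoeff g f p.1 k :=
    fun k => (hms k).comp measurable_fst
  have hm2 := h.measurable_normalizedNoise
  have hm1 : ∀ k, Measurable fun ω => signalCoeff g f (fun j => τ j ω) k := fun k =>
    (measurable_signalCoeff k).comp (measurable_pi_lambda _ h.measurable_shift)
  have hG : 0 ≤ ∑ k ∈ gap M m, ‖templateCoeff f k‖ ^ 2 :=
    Finset.sum_nonneg fun _ _ => by positivity
  -- Given the shifts, the noise is centred, so the mean square error is a squared bias plus the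
  -- noise variance; the bias is dropped.
  have hterm : ∀ k, ENNReal.ofReal (‖noiseWeight g ε n k‖ ^ 2) ≤
      ∫⁻ ω, ENNReal.ofReal (‖signalCoeff g f (fun j => τ j ω) k +
        noiseWeight g ε n k * normalizedNoise z k ω - templateCoeff f k‖ ^ 2) ∂μ := fun k => by
    rw [h.lintegral_shift_noise (F := fun x y => ENNReal.ofReal (‖signalCoeff g f x k +
        noiseWeight g ε n k * y k - templateCoeff f k‖ ^ 2))
        (by unfold Function.uncurry; fun_prop)]
    calc ENNReal.ofReal (‖noiseWeight g ε n k‖ ^ 2)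
        = ∫⁻ _, ENNReal.ofReal (‖noiseWeight g ε n k‖ ^ 2) ∂μ := by simp
      _ ≤ _ := by
        refine lintegral_mono fun ω => ?_
        rw [h.lintegral_comp_normalizedNoise hn k (F := fun y => ENNReal.ofReal
          (‖signalCoeff g f (fun j => τ j ω) k + noiseWeight g ε n k * y -
            templateCoeff f k‖ ^ 2)) (by fun_prop)]
        simp_rw [add_sub_right_comm]
        rw [lintegral_normSq_add_stdComplexGaussian]
        exact ENNReal.ofReal_le_ofReal (le_add_of_nonneg_left (by positivity))
  calc _ = ENNReal.ofReal (∑ k ∈ gap M m, ‖templateCoeff f k‖ ^ 2) +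
        ∑ k ∈ window M, ENNReal.ofReal (‖noiseWeight g ε n k‖ ^ 2) := by
        rw [ENNReal.ofReal_add hG (Finset.sum_nonneg fun _ _ => by positivity),
          ENNReal.ofReal_sum_of_nonneg (s := window M) fun _ _ => by positivity]
    _ ≤ ∫⁻ _, ENNReal.ofReal (∑ k ∈ gap M m, ‖templateCoeff f k‖ ^ 2) ∂μ +
        ∑ k ∈ window M, ∫⁻ ω, ENNReal.ofReal (‖signalCoeff g f (fun j => τ j ω) k +
        noiseWeight g ε n k * normalizedNoise z k ω - templateCoeff f k‖ ^ 2) ∂μ := by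
        refine add_le_add (by simp) (Finset.sum_le_sum fun k _ => hterm k)
    _ = ∫⁻ ω, (ENNReal.ofReal (∑ k ∈ gap M m, ‖templateCoeff f k‖ ^ 2) +
        ∑ k ∈ window M, ENNReal.ofReal (‖signalCoeff g f (fun j => τ j ω) k +
        noiseWeight g ε n k * normalizedNoise z k ω - templateCoeff f k‖ ^ 2)) ∂μ := by
        rw [lintegral_add_left measurable_const, lintegral_finsetSum _ fun k _ => by fun_prop]
    _ ≤ _ := by
        refine lintegral_mono fun ω => ?_
        rw [sqLoss_meanCoeff_eq hf hn, ← ENNReal.ofReal_sum_of_nonneg fun _ _ => by positivity,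
          ← ENNReal.ofReal_add hG (Finset.sum_nonneg fun _ _ => by positivity)]
        refine ENNReal.ofReal_le_ofReal ?_
        have h1 := sum_window_le_normSq hf m
        rw [sum_window_add_gap hM] at h1
        rw [Finset.sum_sub_distrib]
        linarith

/-- The event depends only on the shifts and the crude bound only on the noise, so the expectation
factorises and no Cauchy–Schwarz loss occurs. -/
lemma IsShiftModel.lintegral_indicator_crude [IsProbabilityMeasure μ] (h : IsShiftModel μ g τ z)
    (hn : 0 < n) {B : Set (Fin n → ℝ)} (hB : MeasurableSet B) {a : ℝ} (ha : 0 ≤ a) (m : ℕ) :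
    ∫⁻ ω, B.indicator 1 (fun j => τ j ω) * ENNReal.ofReal (a + ∑ k ∈ window m,
        2 * ‖noiseWeight g ε n k‖ ^ 2 * ‖normalizedNoise z k ω‖ ^ 2) ∂μ =
      μ {ω | (fun j => τ j ω) ∈ B} *
        ENNReal.ofReal (a + 2 * ∑ k ∈ window m, ‖noiseWeight g ε n k‖ ^ 2) := by
  have hm1 : Measurable fun ω (j : Fin n) => τ j ω := measurable_pi_lambda _ h.measurable_shift
  have hm2 := h.measurable_normalizedNoise
  have hBm : Measurable (B.indicator 1 : (Fin n → ℝ) → ℝ≥0∞) := measurable_one.indicator hB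
  have hBm' : Measurable fun p : (Fin n → ℝ) × (ℤ → ℂ) => (B.indicator 1 p.1 : ℝ≥0∞) :=
    hBm.comp measurable_fst
  have hin : ∫⁻ ω, ENNReal.ofReal (a + ∑ k ∈ window m,
      2 * ‖noiseWeight g ε n k‖ ^ 2 * ‖normalizedNoise z k ω‖ ^ 2) ∂μ =
      ENNReal.ofReal (a + 2 * ∑ k ∈ window m, ‖noiseWeight g ε n k‖ ^ 2) := by
    have hsplit : ∀ ω, ENNReal.ofReal (a + ∑ k ∈ window m,
        2 * ‖noiseWeight g ε n k‖ ^ 2 * ‖normalizedNoise z k ω‖ ^ 2) = ENNReal.ofReal a +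
        ∑ k ∈ window m, ENNReal.ofReal
          (2 * ‖noiseWeight g ε n k‖ ^ 2 * ‖normalizedNoise z k ω‖ ^ 2) := fun ω => by
      rw [ENNReal.ofReal_add ha (Finset.sum_nonneg fun _ _ => by positivity),
        ENNReal.ofReal_sum_of_nonneg fun _ _ => by positivity]
    simp_rw [hsplit]
    rw [lintegral_add_left measurable_const, lintegral_finsetSum _ fun k _ => by fun_prop,
      lintegral_const, measure_univ, mul_one, ENNReal.ofReal_add ha
        (mul_nonneg zero_le_two (Finset.sum_nonneg fun _ _ => by positivity)), Finset.mul_sum,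
      ENNReal.ofReal_sum_of_nonneg fun _ _ => by positivity]
    congr 1
    refine Finset.sum_congr rfl fun k _ => ?_
    simp_rw [ENNReal.ofReal_mul (by positivity : 0 ≤ 2 * ‖noiseWeight g ε n k‖ ^ 2)]
    rw [lintegral_const_mul _ (by fun_prop), h.lintegral_comp_normalizedNoise hn k
      (F := fun y => ENNReal.ofReal (‖y‖ ^ 2)) (by fun_prop), lintegral_normSq_stdComplexGaussian,
      mul_one]
  rw [h.lintegral_shift_noise (F := fun x y => B.indicator 1 x * ENNReal.ofReal
    (a + ∑ k ∈ window m, 2 * ‖noiseWeight g ε n k‖ ^ 2 * ‖y k‖ ^ 2))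
    (by unfold Function.uncurry; fun_prop)]
  have hc : ∀ x : Fin n → ℝ, ∫⁻ ω', B.indicator 1 x * ENNReal.ofReal (a + ∑ k ∈ window m,
      2 * ‖noiseWeight g ε n k‖ ^ 2 * ‖normalizedNoise z k ω'‖ ^ 2) ∂μ =
      B.indicator 1 x *
        ENNReal.ofReal (a + 2 * ∑ k ∈ window m, ‖noiseWeight g ε n k‖ ^ 2) := fun x => by
    rw [lintegral_const_mul _ (by fun_prop), hin]
  simp_rw [hc]
  rw [lintegral_mul_const (f := fun ω => B.indicator 1 fun j => τ j ω) _ (hBm.comp hm1)]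
  congr 1
  have : ∀ ω, B.indicator (1 : (Fin n → ℝ) → ℝ≥0∞) (fun j => τ j ω) =
      ({ω | (fun j => τ j ω) ∈ B} : Set Ω).indicator 1 ω := fun ω => by
    by_cases hω : (fun j => τ j ω) ∈ B <;> simp [hω]
  simp_rw [this]
  exact lintegral_indicator_one (hm1 hB)

/-- The oracle inequality before the choice of the parameters. -/
theorem IsShiftModel.cutoffRisk_le [IsProbabilityMeasure μ] (h : IsShiftModel μ g τ z)
    (hg : IsDensity g) (hne : ∀ k, shiftCoeff g k ≠ 0)
    (hf : Summable fun k => ‖templateCoeff f k‖ ^ 2) (hn : 2 ≤ n) {Ntilde : Ω → ℕ}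
    (hN : ∀ ω, IsCriterionMin g ε n (fun k => meanCoeff f ε τ z k ω) (Ntilde ω))
    {M : ℕ} (hM : M ≤ maxCutoff g n) {κ t R X : ℝ} (hκ : 0 ≤ κ) (hκ' : κ ≤ 1 / 16) (ht : 0 ≤ t)
    (ht' : t ≤ 1 / 4)
    (hR : ∫⁻ ω, ENNReal.ofReal (noiseOvershoot (templateCoeff f)
      (signalCoeff g f fun j => τ j ω) (noiseWeight g ε n) (fun k => normalizedNoise z k ω) κ
      (maxCutoff g n) M) ∂μ ≤ ENNReal.ofReal R)
    (hX : (t + κ) * (∑ k ∈ gap M (maxCutoff g n), ‖templateCoeff f k‖ ^ 2 +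
      ∑ k ∈ window M, ‖noiseWeight g ε n k‖ ^ 2) ≤ X ∨
      ∑ k ∈ window (maxCutoff g n), ‖noiseWeight g ε n k‖ ^ 2 ≤ X) :
    cutoffRisk μ g f ε τ z Ntilde ≤ cutoffRisk μ g f ε τ z (fun _ => M) +
      ENNReal.ofReal (100 * X) + ENNReal.ofReal (100 * R) +
      μ {ω | (fun j => τ j ω) ∉ goodShifts g n (maxCutoff g n) t} *
        ENNReal.ofReal ((1 + 32 * n) * normSq (templateCoeff f) +
          2 * ∑ k ∈ window (maxCutoff g n), ‖noiseWeight g ε n k‖ ^ 2) := by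
  have hn0 : 0 < n := by omega
  set m := maxCutoff g n with hm
  have hm2 := h.measurable_normalizedNoise
  have hm1 : ∀ k, Measurable fun ω => signalCoeff g f (fun j => τ j ω) k := fun k =>
    (measurable_signalCoeff k).comp (measurable_pi_lambda _ h.measurable_shift)
  have hnormSq : 0 ≤ normSq (templateCoeff f) := tsum_nonneg fun _ => by positivity
  have hX0 : 0 ≤ X := by
    rcases hX with hX | hX
    · refine le_trans (mul_nonneg (add_nonneg ht hκ) (add_nonneg ?_ ?_)) hX <;>
        exact Finset.sum_nonneg fun _ _ => by positivity
    · exact le_trans (Finset.sum_nonneg fun _ _ => by positivity) hX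
  -- For good shifts this is the deterministic comparison with `E` the overshoot; otherwise the
  -- crude bound applies. The right side is free of `Ntilde`.
  have hpath : ∀ ω, sqLoss (filterEstimator g (cutoffFilter (Ntilde ω))
        (fun k => meanCoeff f ε τ z k ω)) (templateCoeff f) ≤
      sqLoss (filterEstimator g (cutoffFilter M) (fun k => meanCoeff f ε τ z k ω))
        (templateCoeff f) + ENNReal.ofReal (100 * X) +
      ENNReal.ofReal 100 * ENNReal.ofReal (noiseOvershoot (templateCoeff f)
        (signalCoeff g f fun j => τ j ω) (noiseWeight g ε n) (fun k => normalizedNoise z k ω) κ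
        m M) +
      (goodShifts g n m t)ᶜ.indicator 1 (fun j => τ j ω) *
        ENNReal.ofReal ((1 + 32 * n) * normSq (templateCoeff f) + ∑ k ∈ window m,
          2 * ‖noiseWeight g ε n k‖ ^ 2 * ‖normalizedNoise z k ω‖ ^ 2) := fun ω => by
    by_cases hω : (fun j => τ j ω) ∈ goodShifts g n m t
    · refine le_trans ?_ le_self_add
      set E := noiseOvershoot (templateCoeff f) (signalCoeff g f fun j => τ j ω)
        (noiseWeight g ε n) (fun k => normalizedNoise z k ω) κ m M with hE
      have hE0 : 0 ≤ E := noiseOvershoot_nonneg _ _ _ _ _ _ _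
      have hcr := (hN ω).2 M hM
      rw [criterion_eq, criterion_eq] at hcr
      simp_rw [meanCoeff_div τ z hn0] at hcr
      have ho := fun {L} (hL : L ≤ m) => le_noiseOvershoot (templateCoeff f)
        (signalCoeff g f fun j => τ j ω) (noiseWeight g ε n) (fun k => normalizedNoise z k ω) κ
        (M := M) hL
      have key := loss_le_of_criterion_le (θ := templateCoeff f) hκ hκ' ht ht' hE0
        (fun k => by positivity) hM (hN ω).1 hcr (fun k hk => by
          have e : signalCoeff g f (fun j => τ j ω) k - templateCoeff f k = templateCoeff f k *
              ((empiricalCoeff k (fun j => τ j ω) - shiftCoeff g k) / shiftCoeff g k) := by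
            have := hne k
            rw [signalCoeff]
            field_simp
          rw [e, norm_mul, norm_div, mul_comm t]
          refine mul_le_mul_of_nonneg_left ?_ (norm_nonneg _)
          rw [div_le_iff₀ (norm_pos_iff.2 (hne k))]
          exact hω k hk)
        (ho (hN ω).1).1 (ho (hN ω).1).2.1 (fun L hL => (ho hL).2.2)
      rw [sqLoss_meanCoeff_eq hf hn0, sqLoss_meanCoeff_eq hf hn0, ← ENNReal.ofReal_mul (by norm_num)]
      refine le_trans (ENNReal.ofReal_le_ofReal ?_)
        ((ENNReal.ofReal_add_le).trans (add_le_add_left ENNReal.ofReal_add_le _))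
      rcases hX with hX | hX
      · linarith [key.1]
      · linarith [key.2]
    · refine le_trans (sqLoss_le_crude hg hne hf hn (hN ω).1 ω) ?_
      rw [Set.indicator_of_mem (show (fun j => τ j ω) ∈ (goodShifts g n m t)ᶜ from hω),
        Pi.one_apply, one_mul]
      exact le_add_self
  have hsq : Measurable fun ω => sqLoss (filterEstimator g (cutoffFilter M)
      (fun k => meanCoeff f ε τ z k ω)) (templateCoeff f) := by
    simp_rw [sqLoss_meanCoeff_eq hf hn0]
    fun_prop
  have hov : Measurable fun ω => ENNReal.ofReal (noiseOvershoot (templateCoeff f)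
      (signalCoeff g f fun j => τ j ω) (noiseWeight g ε n) (fun k => normalizedNoise z k ω) κ
      m M) := by
    unfold noiseOvershoot
    fun_prop
  refine (lintegral_mono hpath).trans ?_
  rw [lintegral_add_left (by fun_prop), lintegral_add_left (by fun_prop),
    lintegral_add_left hsq, lintegral_const, measure_univ, mul_one, lintegral_const_mul _ hov,
    h.lintegral_indicator_crude hn0 (measurableSet_goodShifts n m t).compl (by positivity),
    ENNReal.ofReal_mul (p := 100) (q := R) (by norm_num)]
  exact add_le_add (add_le_add le_rfl (by gcongr)) le_rfl

end Risk

/-! ### Choice of the shift tolerance `t` and the resulting oracle inequality. -/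

section Oracle

variable {Ω : Type*} {g f : ℝ → ℝ} {ε : ℝ} {n : ℕ} {τ : Fin n → Ω → ℝ} {z : ℤ → Fin n → Ω → ℂ}

lemma sum_noiseWeight_le (hg : IsDensity g) (hn : 2 ≤ n) {C : ℝ} {q : ℕ}
    (hm : 2 * (maxCutoff g n : ℝ) + 1 ≤ C * n ^ q) :
    ∑ k ∈ window (maxCutoff g n), ‖noiseWeight g ε n k‖ ^ 2 ≤
      ε ^ 2 / n * (4 * C * n ^ (q + 1)) := by
  simp_rw [norm_noiseWeight_sq]
  rw [← Finset.mul_sum]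
  gcongr
  calc ∑ k ∈ window (maxCutoff g n), (‖shiftCoeff g k‖ ^ 2)⁻¹
      ≤ (window (maxCutoff g n)).card • (4 * (n : ℝ)) :=
        Finset.sum_le_card_nsmul _ _ _ fun k hk => inv_normSq_le_of_mem_window hg hn hk
    _ = (2 * (maxCutoff g n : ℝ) + 1) * (4 * n) := by rw [nsmul_eq_mul, card_window]
    _ ≤ C * n ^ q * (4 * n) := by gcongr
    _ = _ := by ring

variable [MeasurableSpace Ω] {μ : Measure Ω}

/-- This serves the finitely many small `n`, where `t ≤ 1 / 4` is not available. -/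
lemma IsShiftModel.cutoffRisk_le_crude [IsProbabilityMeasure μ] (h : IsShiftModel μ g τ z)
    (hg : IsDensity g) (hne : ∀ k, shiftCoeff g k ≠ 0)
    (hf : Summable fun k => ‖templateCoeff f k‖ ^ 2) (hn : 2 ≤ n) {Ntilde : Ω → ℕ}
    (hN : ∀ ω, Ntilde ω ≤ maxCutoff g n) :
    cutoffRisk μ g f ε τ z Ntilde ≤ ENNReal.ofReal ((1 + 32 * n) * normSq (templateCoeff f) +
      2 * ∑ k ∈ window (maxCutoff g n), ‖noiseWeight g ε n k‖ ^ 2) := by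
  have h0 : 0 ≤ normSq (templateCoeff f) := tsum_nonneg fun _ => by positivity
  have h1 := h.lintegral_indicator_crude (ε := ε) (a := (1 + 32 * n) * normSq (templateCoeff f))
    (by omega) MeasurableSet.univ (by positivity) (maxCutoff g n)
  simp only [Set.indicator_univ, Pi.one_apply, one_mul, Set.mem_univ, Set.ofPred_true,
    measure_univ] at h1
  rw [← h1]
  exact lintegral_mono fun ω => sqLoss_le_crude hg hne hf hn (hN ω) ω

lemma exists_min_cutoff (F : ℕ → ℝ≥0∞) (m : ℕ) :
    ∃ M ≤ m, (⨅ N ∈ Set.Iic m, F N) = F M := by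
  obtain ⟨M, hM, hmin⟩ := Finset.exists_min_image (Finset.Iic m) F ⟨0, by simp⟩
  rw [Finset.mem_Iic] at hM
  refine ⟨M, hM, le_antisymm (iInf₂_le M hM) (le_iInf₂ fun N hN => hmin N ?_)⟩
  exact Finset.mem_Iic.2 hN

/-- The oracle inequality with a polynomially small failure probability. -/
lemma IsShiftModel.cutoffRisk_le_of_log_le [IsProbabilityMeasure μ] (h : IsShiftModel μ g τ z)
    (hg : IsDensity g) (hne : ∀ k, shiftCoeff g k ≠ 0)
    (hf : Summable fun k => ‖templateCoeff f k‖ ^ 2) (hn : 2 ≤ n) (hε : 0 < ε) {Ntilde : Ω → ℕ}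
    (hN : ∀ ω, IsCriterionMin g ε n (fun k => meanCoeff f ε τ z k ω) (Ntilde ω))
    {M : ℕ} (hM : M ≤ maxCutoff g n) {κ A c C C' X : ℝ} {q r : ℕ} (hκ : 0 < κ) (hκ' : κ ≤ 1 / 16)
    (hA : normSq (templateCoeff f) ≤ A) (hc : 0 < c) (hC : 0 < C)
    (hw : ∀ M : ℕ, ∃ D > 0, (∀ k ∈ window M, (‖shiftCoeff g k‖ ^ 2)⁻¹ ≤ D) ∧
      c * (M + 1) ≤ (∑ k ∈ window M, (‖shiftCoeff g k‖ ^ 2)⁻¹) / D ∧ D ≤ C * (M + 1) ^ r)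
    (hC' : 0 < C') (hm : 2 * (maxCutoff g n : ℝ) + 1 ≤ C' * n ^ q)
    (hlog : 16 * (16 * (q + 1)) ≤ Real.log n)
    (hX : (√(16 * (q + 1) / Real.log n) + κ) *
      (∑ k ∈ gap M (maxCutoff g n), ‖templateCoeff f k‖ ^ 2 +
      ∑ k ∈ window M, ‖noiseWeight g ε n k‖ ^ 2) ≤ X ∨
      ∑ k ∈ window (maxCutoff g n), ‖noiseWeight g ε n k‖ ^ 2 ≤ X) :
    cutoffRisk μ g f ε τ z Ntilde ≤ cutoffRisk μ g f ε τ z (fun _ => M) +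
      ENNReal.ofReal (100 * X) +
      ENNReal.ofReal (600 * (4 * C * (r + 2).factorial * (4 / c) ^ (r + 2)) *
        (ε ^ 2 / n) / κ ^ (2 * r + 5) +
        (132 * C' * A / n + 32 * C' ^ 2 * (ε ^ 2 / n))) := by
  have hn1 : (1 : ℝ) ≤ n := by exact_mod_cast (by omega : 1 ≤ n)
  have hn0 : (0 : ℝ) < n := by linarith
  have hlog0 : 0 < Real.log n := lt_of_lt_of_le (by positivity) hlog
  have hT : 0 ≤ normSq (templateCoeff f) := tsum_nonneg fun _ => by positivity
  have hA0 : 0 ≤ A := hT.trans hA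
  -- With this `t` each frequency fails with probability at most `4 n^(-(2q+2))`. The `C' n^q`
  -- frequencies then give `4 C' n^(-(q+2))`, enough against a crude loss of order `n A + ε² n^q`.
  -- The assumption `hlog` is `t² ≤ 1 / 16`.
  set t := √(16 * (q + 1) / Real.log n) with ht
  have ht2 : t ^ 2 = 16 * (q + 1) / Real.log n := Real.sq_sqrt (by positivity)
  have ht' : t ≤ 1 / 4 := by
    rw [ht, Real.sqrt_le_left (by norm_num), div_le_iff₀ hlog0]
    linarith
  have h1 := h.cutoffRisk_le hg hne hf hn hN hM hκ.le hκ' (Real.sqrt_nonneg _) ht'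
    (h.lintegral_noiseOvershoot_le (f := f) (by omega) hε hκ (by linarith) hc hC hw _ M) hX
  refine h1.trans ?_
  rw [add_assoc]
  refine add_le_add le_rfl ?_
  have hS := sum_noiseWeight_le (ε := ε) hg hn hm
  have hp := h.measureReal_not_goodShifts_le hg (by omega) (Real.sqrt_nonneg _ : 0 ≤ t)
  have hexp : Real.exp (-(t ^ 2 * Real.log n ^ 2) / 8) = ((n : ℝ) ^ (2 * q + 2))⁻¹ := by
    have : -(t ^ 2 * Real.log n ^ 2) / 8 = -(((2 * q + 2 : ℕ) : ℝ) * Real.log n) := by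
      rw [ht2]; push_cast; field_simp; ring
    rw [this, Real.exp_neg, Real.exp_nat_mul, Real.exp_log hn0]
  have hp' : μ.real {ω | (fun j => τ j ω) ∉ goodShifts g n (maxCutoff g n) t} ≤
      4 * C' * ((n : ℝ) ^ (q + 2))⁻¹ := by
    refine hp.trans ?_
    rw [hexp]
    calc (2 * (maxCutoff g n : ℝ) + 1) * (4 * ((n : ℝ) ^ (2 * q + 2))⁻¹)
        ≤ C' * n ^ q * (4 * ((n : ℝ) ^ (2 * q + 2))⁻¹) := by gcongr
      _ = 4 * C' * ((n : ℝ) ^ (q + 2))⁻¹ := by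
        rw [show 2 * q + 2 = q + (q + 2) by ring, pow_add (n : ℝ) q (q + 2)]
        field_simp
  have hS0 : 0 ≤ ∑ k ∈ window (maxCutoff g n), ‖noiseWeight g ε n k‖ ^ 2 :=
    Finset.sum_nonneg fun _ _ => by positivity
  rw [← ofReal_measureReal, ← ENNReal.ofReal_mul measureReal_nonneg,
    ← ENNReal.ofReal_add (by positivity) (by positivity)]
  refine ENNReal.ofReal_le_ofReal (add_le_add (le_of_eq (by ring)) ?_)
  calc μ.real {ω | (fun j => τ j ω) ∉ goodShifts g n (maxCutoff g n) t} *
        ((1 + 32 * n) * normSq (templateCoeff f) +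
          2 * ∑ k ∈ window (maxCutoff g n), ‖noiseWeight g ε n k‖ ^ 2)
      ≤ 4 * C' * ((n : ℝ) ^ (q + 2))⁻¹ *
        ((33 * n) * A + 2 * (ε ^ 2 / n * (4 * C' * n ^ (q + 1)))) := by
        gcongr
        linarith
    _ = 132 * C' * A / n * ((n : ℝ) ^ q)⁻¹ + 32 * C' ^ 2 * (ε ^ 2 / n) * (n : ℝ)⁻¹ := by
        rw [pow_add, pow_add]
        field_simp
        ring
    _ ≤ 132 * C' * A / n * 1 + 32 * C' ^ 2 * (ε ^ 2 / n) * 1 := by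
        have : ((n : ℝ) ^ q)⁻¹ ≤ 1 := inv_le_one_of_one_le₀ (one_le_pow₀ hn1)
        have : (n : ℝ)⁻¹ ≤ 1 := inv_le_one_of_one_le₀ hn1
        gcongr
    _ = _ := by ring

/-- The relative excess in the oracle inequality vanishes with `γ`. -/
lemma tendsto_relative_excess (a : ℝ) {p : ℝ} (hp : 0 < p) :
    Filter.Tendsto (fun γ : ℝ => 100 * (√(a / -Real.log γ) + γ ^ p)) (𝓝[>] 0) (𝓝 0) := by
  have h1 : Filter.Tendsto (fun γ : ℝ => -Real.log γ) (𝓝[>] 0) Filter.atTop :=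
    Filter.tendsto_neg_atBot_atTop.comp Real.tendsto_log_nhdsGT_zero
  have h2 : Filter.Tendsto (fun γ : ℝ => √(a / -Real.log γ)) (𝓝[>] 0) (𝓝 0) := by
    have := (Real.continuous_sqrt.tendsto 0).comp (h1.const_div_atTop a)
    rwa [Real.sqrt_zero] at this
  have h3 : Filter.Tendsto (fun γ : ℝ => γ ^ p) (𝓝[>] 0) (𝓝 0) := by
    have := (Real.continuousAt_rpow_const 0 p (Or.inr hp.le)).tendsto
    rw [Real.zero_rpow hp.ne'] at this
    exact this.mono_left nhdsWithin_le_nhds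
  simpa using (h2.add h3).const_mul 100

end Oracle

end RandomShift

end

/-! ### The main theorem: choice of `κ` and of the constants, and the regimes of `n` and `γ`. -/

set_option maxHeartbeats 1000000 in
theorem mainTheorem2
    (g : ℝ → ℝ) (hg : RandomShift.IsDensity g)
    (β Cmin Cmax : ℝ) (hβ : 0 ≤ β) (hCmin : 0 < Cmin) (hCmax : Cmin ≤ Cmax)
    (hdecay : RandomShift.PolynomialDecay g β Cmin Cmax) :
    ∃ γ₂ : ℝ, 0 < γ₂ ∧ γ₂ < 1 ∧
    ∃ h₂ : ℝ → ℝ, Filter.Tendsto h₂ (𝓝[>] 0) (𝓝 0) ∧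
    ∀ A : ℝ, ∃ C₂ : ℝ, 0 < C₂ ∧
    ∀ f : ℝ → ℝ, Function.Periodic f 1 →
      MemLp f 2 (volume.restrict (Set.Icc (0 : ℝ) 1)) →
      RandomShift.normSq (RandomShift.templateCoeff f) ≤ A →
    ∀ (n : ℕ), 2 ≤ n → ∀ ε : ℝ, 0 < ε →
    ∀ (Ω : Type*) [MeasurableSpace Ω] (μ : Measure Ω) [IsProbabilityMeasure μ]
      (τ : Fin n → Ω → ℝ) (z : ℤ → Fin n → Ω → ℂ),
      RandomShift.IsShiftModel μ g τ z →
    ∀ Ntilde : Ω → ℕ, Measurable Ntilde →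
      (∀ ω, RandomShift.IsCriterionMin g ε n
        (fun k => RandomShift.meanCoeff f ε τ z k ω) (Ntilde ω)) →
    ∀ γ : ℝ, 0 < γ → γ < γ₂ →
      RandomShift.cutoffRisk μ g f ε τ z Ntilde ≤
        ENNReal.ofReal (1 + h₂ γ) *
            (⨅ N ∈ Set.Iic (RandomShift.maxCutoff g n),
              RandomShift.cutoffRisk μ g f ε τ z (fun _ => N))
          + ENNReal.ofReal
              (C₂ * ε ^ 2 / n *
                  (RandomShift.normSq (RandomShift.templateCoeff f) * Real.log n ^ 2 / γ ^ 2)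
                    ^ (2 * β)
                + C₂ * ε ^ 2 / n * (1 / γ ^ (4 * β + 1))
                + C₂ / n) := by
  obtain ⟨c, hc, C, hC, r, hw⟩ := hdecay.exists_weight_bound hg hβ hCmin hCmax
  obtain ⟨C', hC', q, hm⟩ := hdecay.exists_maxCutoff_le hg (hdecay.exponent_pos hβ hCmin) hCmin
  have hne := hdecay.shiftCoeff_ne_zero hg hCmin
  set P := 2 * r + 5 with hP
  set B := 600 * (4 * C * (r + 2).factorial * (4 / c) ^ (r + 2)) with hB
  have hB0 : 0 ≤ B := by positivity
  set n₀ := Real.exp (16 * (16 * (q + 1))) with hn₀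
  -- The choice `κ = γ^(1/P)` makes `κ^(-P) = γ⁻¹`, and `γ < (1/16)^P` ensures `κ ≤ 1 / 16`. The
  -- square root in `h₂` is the value of `t` after `log n` is replaced by its lower bound `-log γ /
  -- (q + 1)`.
  refine ⟨(1 / 16 : ℝ) ^ P, by positivity, pow_lt_one₀ (by norm_num) (by norm_num) (by omega),
    fun γ => 100 * (√(16 * (q + 1) ^ 2 / -Real.log γ) + γ ^ (P : ℝ)⁻¹),
    RandomShift.tendsto_relative_excess _ (by positivity), fun A => ?_⟩
  set C₂ := 1 + 33 * n₀ ^ 2 * |A| + 8 * C' * n₀ ^ (q + 1) + 132 * C' * |A| + 32 * C' ^ 2 + B +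
    400 * C' with hC₂
  refine ⟨C₂, by positivity, ?_⟩
  intro f _ hf hA n hn ε hε Ω _ μ _ τ z h Ntilde _ hN γ hγ hγ₂
  replace hf := RandomShift.summable_normSq_templateCoeff hf
  obtain ⟨M, hM, hinf⟩ := RandomShift.exists_min_cutoff
    (fun N => RandomShift.cutoffRisk μ g f ε τ z (fun _ => N)) (RandomShift.maxCutoff g n)
  rw [hinf]
  have hn1 : (1 : ℝ) ≤ n := by exact_mod_cast (by omega : 1 ≤ n)
  have hn0 : (0 : ℝ) < n := by linarith
  have hγ1 : γ < 1 := hγ₂.trans (pow_lt_one₀ (by norm_num) (by norm_num) (by omega))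
  have hlogγ : 0 < -Real.log γ := neg_pos.2 (Real.log_neg hγ hγ1)
  have hA' : RandomShift.normSq (RandomShift.templateCoeff f) ≤ |A| := hA.trans (le_abs_self A)
  have hT : 0 ≤ RandomShift.normSq (RandomShift.templateCoeff f) :=
    tsum_nonneg fun _ => by positivity
  set κ := γ ^ (P : ℝ)⁻¹ with hκ
  have hκ0 : 0 < κ := by positivity
  have hκP : κ ^ P = γ := by rw [hκ, Real.rpow_inv_natCast_pow hγ.le (by omega)]
  have hκ16 : κ ≤ 1 / 16 := by
    refine (lt_of_pow_lt_pow_left₀ P (by norm_num) ?_).le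
    rwa [hκP]
  set s := ε ^ 2 / n with hs
  have hs0 : 0 < s := by positivity
  have hγG : γ⁻¹ ≤ 1 / γ ^ (4 * β + 1) := by
    rw [one_div]
    gcongr
    calc γ ^ (4 * β + 1) ≤ γ ^ (1 : ℝ) :=
          Real.rpow_le_rpow_of_exponent_ge hγ hγ1.le (by linarith)
      _ = γ := Real.rpow_one _
  have hG1 : 1 ≤ γ⁻¹ := (one_le_inv₀ hγ).2 hγ1.le
  have hh0 : 0 ≤ 100 * (√(16 * (q + 1) ^ 2 / -Real.log γ) + κ) := by positivity
  -- All remainders fit into `ε²/(nγ) + 1/n` up to constants; the term with `log² n` is needed only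
  -- through its nonnegativity.
  have hRHS : ∀ Z : ℝ, Z ≤ C₂ * s * γ⁻¹ + C₂ / n → ENNReal.ofReal Z ≤ ENNReal.ofReal
      (C₂ * ε ^ 2 / n * (RandomShift.normSq (RandomShift.templateCoeff f) *
        Real.log n ^ 2 / γ ^ 2) ^ (2 * β) + C₂ * ε ^ 2 / n * (1 / γ ^ (4 * β + 1)) + C₂ / n) :=
    fun Z hZ => by
    refine ENNReal.ofReal_le_ofReal (hZ.trans ?_)
    have h1 : 0 ≤ C₂ * ε ^ 2 / n * (RandomShift.normSq (RandomShift.templateCoeff f) *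
        Real.log n ^ 2 / γ ^ 2) ^ (2 * β) := by positivity
    have h2 : C₂ * s * γ⁻¹ ≤ C₂ * s * (1 / γ ^ (4 * β + 1)) := by gcongr
    have h3 : C₂ * ε ^ 2 / n = C₂ * s := by rw [hs]; ring
    rw [h3] at h1 ⊢
    linarith
  have hS := RandomShift.sum_noiseWeight_le (ε := ε) hg hn (hm n hn)
  rw [← hs] at hS
  have hprod : ∀ a : ℝ, 0 ≤ a → a * s ≤ a * s * γ⁻¹ := fun a ha =>
    le_mul_of_one_le_right (by positivity) hG1
  -- Below the threshold `n ≤ n₀`, so the crude bound is `C₂ (ε²/n + 1/n)` with powers of `n₀`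
  -- inside `C₂`.
  rcases lt_or_ge (Real.log n) (16 * (16 * (q + 1))) with hlog | hlog
  · have hnn : (n : ℝ) ≤ n₀ := ((Real.log_lt_iff_lt_exp hn0).1 hlog).le
    refine (h.cutoffRisk_le_crude hg hne hf hn fun ω => (hN ω).1).trans
      ((hRHS _ ?_).trans le_add_self)
    have h1 : (1 + 32 * n) * RandomShift.normSq (RandomShift.templateCoeff f) ≤
        33 * n₀ ^ 2 * |A| / n := by
      rw [le_div_iff₀ hn0]
      calc (1 + 32 * (n : ℝ)) * RandomShift.normSq (RandomShift.templateCoeff f) * n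
          ≤ (33 * n) * |A| * n := by gcongr; linarith
        _ = 33 * (n : ℝ) ^ 2 * |A| := by ring
        _ ≤ _ := by gcongr
    have h2 : s * (4 * C' * n ^ (q + 1)) ≤ 4 * C' * n₀ ^ (q + 1) * s := by
      rw [mul_comm]; gcongr
    have h3 := hprod (8 * C' * n₀ ^ (q + 1)) (by positivity)
    have h4 : 8 * C' * n₀ ^ (q + 1) * s * γ⁻¹ ≤ C₂ * s * γ⁻¹ := by
      gcongr
      rw [hC₂]
      have : 0 ≤ 33 * n₀ ^ 2 * |A| + 132 * C' * |A| + 32 * C' ^ 2 + B + 400 * C' := by positivity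
      linarith
    have h5 : 33 * n₀ ^ 2 * |A| / n ≤ C₂ / n := by
      gcongr
      rw [hC₂]
      have : 0 ≤ 8 * C' * n₀ ^ (q + 1) + 132 * C' * |A| + 32 * C' ^ 2 + B + 400 * C' := by
        positivity
      linarith
    linarith only [hS, h1, h2, h3, h4, h5]
  · have hlog0 : 0 < Real.log n := lt_of_lt_of_le (by positivity) hlog
    have h1 := fun {X : ℝ} => h.cutoffRisk_le_of_log_le (X := X) hg hne hf hn hε hN hM hκ0 hκ16 hA'
      hc hC hw hC' (hm n hn) hlog
    have e1 : B * s / κ ^ P = B * s * γ⁻¹ := by rw [hκP, div_eq_mul_inv]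
    rw [← hB, ← hs, ← hP, e1] at h1
    have hc1 := hprod (32 * C' ^ 2) (by positivity)
    have hA2 : 132 * C' * |A| / n ≤ C₂ / n := by
      gcongr
      rw [hC₂]
      have : 0 ≤ 33 * n₀ ^ 2 * |A| + 8 * C' * n₀ ^ (q + 1) + 32 * C' ^ 2 + B + 400 * C' := by
        positivity
      linarith
    have hsum : 400 * C' * s * γ⁻¹ + B * s * γ⁻¹ + 32 * C' ^ 2 * s * γ⁻¹ ≤ C₂ * s * γ⁻¹ := by
      rw [← add_mul, ← add_mul, ← add_mul, ← add_mul]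
      gcongr
      rw [hC₂]
      have : 0 ≤ 33 * n₀ ^ 2 * |A| + 8 * C' * n₀ ^ (q + 1) + 132 * C' * |A| := by positivity
      linarith
    have hp : 0 ≤ 400 * C' * s * γ⁻¹ := by positivity
    -- If `n^(q+1) ≤ γ⁻¹`, the total variance, at most `4 C' n^(q+1) ε²/n`, is itself a remainder.
    -- Otherwise `-log γ ≤ (q + 1) log n`, so `t` is absorbed by `h₂ γ`.
    rcases le_or_gt ((n : ℝ) ^ (q + 1)) γ⁻¹ with hreg | hreg
    · refine (h1 (Or.inr hS)).trans ?_
      rw [add_assoc]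
      refine add_le_add ?_ ?_
      · refine le_mul_of_one_le_left zero_le ?_
        rw [← ENNReal.ofReal_one]
        exact ENNReal.ofReal_le_ofReal (by linarith)
      · rw [← ENNReal.ofReal_add (by positivity) (by positivity)]
        refine hRHS _ ?_
        have h5 : 100 * (s * (4 * C' * n ^ (q + 1))) ≤ 400 * C' * s * γ⁻¹ :=
          calc 100 * (s * (4 * C' * n ^ (q + 1))) ≤ 100 * (s * (4 * C' * γ⁻¹)) := by gcongr
            _ = _ := by ring
        linarith only [h5, hsum, hc1, hA2]
    · refine (h1 (Or.inl le_rfl)).trans (add_le_add ?_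
        (hRHS _ (by linarith only [hp, hsum, hc1, hA2])))
      have hlog' : -Real.log γ ≤ (q + 1) * Real.log n := by
        have := Real.log_le_log (by positivity) hreg.le
        rw [Real.log_inv, Real.log_pow] at this
        exact_mod_cast this
      have ht : √(16 * (q + 1) / Real.log n) ≤ √(16 * (q + 1) ^ 2 / -Real.log γ) := by
        refine Real.sqrt_le_sqrt ?_
        rw [div_le_div_iff₀ hlog0 hlogγ]
        nlinarith [mul_le_mul_of_nonneg_left hlog' (by positivity : (0 : ℝ) ≤ 16 * (q + 1))]
      -- Bias plus variance at `M` is at most the risk there, so the excess `100 (t + κ)(bias +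
      -- variance)` becomes `h₂ γ` times the oracle risk.
      have hlow := h.le_cutoffRisk (ε := ε) hf (by omega) hM
      rw [ENNReal.ofReal_add zero_le_one hh0, ENNReal.ofReal_one, one_add_mul, ← mul_assoc,
        ENNReal.ofReal_mul (by positivity)]
      gcongr
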